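/- **Setting.** Let $\phi$ be the density of $N(0,1)$ and $M_q=E|X|^q$ for $X\sim N(0,1)$. Call a density $f$ on $\mathbb R$ *eligible*, with null parameters $(u_0,\sigma_0^2)$ and proportion $\varepsilon$, if $$f(x)=(1-\varepsilon)\frac1{\sigma_0}\phi\Big(\frac{x-u_0}{\sigma_0}\Big)+\varepsilon\iint\frac1\sigma\phi\Big(\frac{x-u}{\sigma}\Big)\,dH(u,\sigma),$$ where $u_0\in\mathbb R$, $\sigma_0>0$, $0<\varepsilon<1$, and $H$ is a probability distribution of $(u,\sigma)$ such that $\sigma$ has its marginal supported on $[\sigma_0,\infty)$ and $u$ given $\sigma$ has a conditional density $h(u|\sigma)$ for every $\sigma\ge\sigma_0$. Put $\hat h(t|\sigma)=\int e^{itu}h(u|\sigma)\,du$ and $\tilde h(t|\sigma)=\int e^{itu}h(u+u_0|\sigma)\,du$. Let $\mathcal F_0(\alpha,\beta,\varepsilon_0,q,a,A;n)$ be the set of eligible $f$ with $$\sigma_0\ge a,\qquad \int|x|^qf(x)\,dx\le A^q,\qquad \varepsilon\le\varepsilon_0n^{-\beta},$$ $$\limsup_{t\to\infty}\sup_{\sigma\ge\sigma_0}|t|^{\alpha}|\hat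 h(t|\sigma)|\le A,\qquad \limsup_{t\to\infty}\sup_{\sigma\ge\sigma_0}|t|^{\alpha+1}|\tilde h'(t|\sigma)|\le A,$$ where the last condition includes that, for all sufficiently large $t$, the derivative $\tilde h'(t|\sigma)$ in $t$ exists for every $\sigma\ge\sigma_0$. For $X_1,\dots,X_n$ i.i.d. with density $f$, define the minimax risks $$R_n^\sigma=\inf_{\hat\sigma_0^2}\ \sup_{f\in\mathcal F_0}E\big[(\hat\sigma_0^2-\sigma_0^2)^2\big],\qquad R_n^u=\inf_{\hat u_0}\ \sup_{f\in\mathcal F_0}E\big[(\hat u_0-u_0)^2\big],$$ where the infima are over all real-valued estimators (measurable functions of $X_1,\dots,X_n$) and $\mathcal F_0=\mathcal F_0(\alpha,\beta,\varepsilon_0,q,a,A;n)$. **Theorem 2.1.** Fix $\alpha>2$, $\beta\in[0,1/2)$, $\varepsilon_0\in(0,1)$, $q>0$, $a>0$ and $A>\sqrt{a^2+1}\,M_q^{1/q}$. There is a constant $C>0$, depending only on $\alpha,\beta,\varepsilon_0,q,a,A$, such that $$\liminf_{n\to\infty}\,n^{2\beta}(\log n)^{\alpha+2}R_n^\sigma\ge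 C\qquad\text{and}\qquad \liminf_{n\to\infty}\,n^{2\beta}(\log n)^{\alpha+1}R_n^u\ge C.$$ -/

import Mathlib

open MeasureTheory ProbabilityTheory Filter

noncomputable section

namespace NullEstimation

/-- A Gaussian mixture model whose marginal density is eligible: null mean `u₀`, null standard
deviation `σ₀ > 0`, proportion `ε ∈ (0,1)` of nonnull effects, and a mixing distribution `H` of
the pair `(u, σ)`, whose `σ`-marginal `H.snd` is supported on `[σ₀, ∞)` and which has a
conditional density `u ↦ h(u|σ)` of `u` given `σ` for every `σ ≥ σ₀`; it is written `h σ u`. -/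
structure EligibleMixture where
  u₀ : ℝ
  σ₀ : ℝ
  ε : ℝ
  H : Measure (ℝ × ℝ)
  h : ℝ → ℝ → ℝ
  σ₀_pos : 0 < σ₀
  ε_pos : 0 < ε
  ε_lt_one : ε < 1
  isProbabilityMeasure_H : IsProbabilityMeasure H
  support_H : H.snd (Set.Iio σ₀) = 0
  measurable_h : Measurable (Function.uncurry h)
  h_nonneg : ∀ σ, σ₀ ≤ σ → ∀ u, 0 ≤ h σ u
  integrable_h : ∀ σ, σ₀ ≤ σ → Integrable (h σ)
  integral_h : ∀ σ, σ₀ ≤ σ → ∫ u, h σ u = 1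
  /-- `dH(u, σ) = h(u|σ) du dH(σ)`. -/
  disintegration : H =
    ((volume : Measure ℝ).prod H.snd).withDensity (fun p => ENNReal.ofReal (h p.2 p.1))

namespace EligibleMixture

/-- The marginal density
`f(x) = (1 - ε) σ₀⁻¹ φ((x - u₀)/σ₀) + ε ∫∫ σ⁻¹ φ((x - u)/σ) dH(u, σ)`,
with `φ` the density of `N(0, 1)`. -/
def density (M : EligibleMixture) (x : ℝ) : ℝ :=
  (1 - M.ε) * (1 / M.σ₀ * gaussianPDFReal 0 1 ((x - M.u₀) / M.σ₀)) +
    M.ε * ∫ p : ℝ × ℝ, 1 / p.2 * gaussianPDFReal 0 1 ((x - p.1) / p.2) ∂M.H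

/-- The distribution on `ℝ` with density `f`. -/
def law (M : EligibleMixture) : Measure ℝ :=
  volume.withDensity (fun x => ENNReal.ofReal (M.density x))

/-- The joint distribution of `n` independent observations with density `f`. -/
def sampleLaw (M : EligibleMixture) (n : ℕ) : Measure (Fin n → ℝ) :=
  Measure.pi (fun _ => M.law)

/-- The characteristic function `ĥ(t|σ) = ∫ e^{itu} h(u|σ) du`. -/
def hHat (M : EligibleMixture) (σ t : ℝ) : ℂ :=
  ∫ u : ℝ, Complex.exp (Complex.I * t * u) * (M.h σ u : ℂ)

/-- The centered characteristic function `h̃(t|σ) = ∫ e^{itu} h(u + u₀|σ) du`. -/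
def hTilde (M : EligibleMixture) (σ t : ℝ) : ℂ :=
  ∫ u : ℝ, Complex.exp (Complex.I * t * u) * (M.h σ (u + M.u₀) : ℂ)

end EligibleMixture

/-- The parameter space `𝓕₀(α, β, ε₀, q, a, A; n)`. Suprema and upper limits are taken in
`[0, ∞]`. -/
structure MemF₀ (α β ε₀ q a A : ℝ) (n : ℕ) (M : EligibleMixture) : Prop where
  le_σ₀ : a ≤ M.σ₀
  moment : ∫⁻ x, ENNReal.ofReal (|x| ^ q * M.density x) ≤ ENNReal.ofReal (A ^ q)
  hHat_decay :
    limsup (fun t : ℝ => ⨆ σ ∈ Set.Ici M.σ₀, ENNReal.ofReal (|t| ^ α * ‖M.hHat σ t‖)) atTop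
      ≤ ENNReal.ofReal A
  /-- For large `t` the derivative of `h̃` that is bounded next exists. -/
  hTilde_differentiable :
    ∀ᶠ t : ℝ in atTop, ∀ σ ∈ Set.Ici M.σ₀, DifferentiableAt ℝ (M.hTilde σ) t
  hTilde_deriv_decay :
    limsup (fun t : ℝ =>
        ⨆ σ ∈ Set.Ici M.σ₀, ENNReal.ofReal (|t| ^ (α + 1) * ‖deriv (M.hTilde σ) t‖)) atTop
      ≤ ENNReal.ofReal A
  ε_le : M.ε ≤ ε₀ * (n : ℝ) ^ (-β)

/-- The minimax mean squared error over `𝓕₀` for estimating the parameter `θ` from `n`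
observations: the infimum over all (measurable) estimators `T` of the supremum over `𝓕₀` of
`E (T(X₁, …, Xₙ) - θ)²`, a number in `[0, ∞]`. -/
def minimaxRisk (θ : EligibleMixture → ℝ) (α β ε₀ q a A : ℝ) (n : ℕ) : ENNReal :=
  ⨅ (T : (Fin n → ℝ) → ℝ) (_ : Measurable T),
    ⨆ (M : EligibleMixture) (_ : MemF₀ α β ε₀ q a A n M),
      ∫⁻ x, ENNReal.ofReal ((T x - θ M) ^ 2) ∂(M.sampleLaw n)

/-- The minimax risk for the null variance `σ₀²`. -/
def riskσ (α β ε₀ q a A : ℝ) (n : ℕ) : ENNReal :=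
  minimaxRisk (fun M => M.σ₀ ^ 2) α β ε₀ q a A n

/-- The minimax risk for the null mean `u₀`. -/
def riskU (α β ε₀ q a A : ℝ) (n : ℕ) : ENNReal :=
  minimaxRisk (fun M => M.u₀) α β ε₀ q a A n

/-- `M_q = E|X|^q` for `X ∼ N(0, 1)`. -/
def gaussianMoment (q : ℝ) : ℝ := ∫ x, |x| ^ q ∂(gaussianReal 0 1)

end NullEstimation

end

noncomputable section

namespace NullEstimation

/-! Le Cam's two-point method. Two members of the class are built whose null means and null
variances both differ by `δ`, of order `n^(-β) (log n)^(-(α+1)/2)`, and whose densities differ by at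
most `1/(2n)` in `L¹`. No estimator based on `n` observations separates them, so both risks are at
least `δ²/8` (`minimaxRisk_ge`, `risk_ge`).

The null parts are `N(0, a²)` and `N(δ, a² + δ)`, with a common proportion `ε = ε₀ n^(-β)`. The
mixing density of the first model must make up for the difference of the null parts. Exact
deconvolution of that difference by `N(0, a²)` would give the density of `N(δ, δ)` minus a Dirac
mass, which is not a function. Both terms are therefore written as `exp(-y²)` times a Fourier
integral, and the integral is cut off at frequencies `|s| ≤ τ` (`shiftKernel`; the difference is
`bump`). The Gaussian weight does two things: it keeps the kernel below a multiple of a Gaussian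
density, so that adding the kernel to such a density leaves it nonnegative
(`abs_shiftKernel_sub_le`), and it gives the characteristic function Gaussian decay
(`gaussianDecay_shiftKernel`). After convolution with `N(0, v)` the cutoff costs only a constant
times `exp(-r τ²/4)`, where `r = (v/2)/(1/2 + v)` (`abs_gaussDens_sub_conv_shiftKernel_le`).

With `τ² = (8/r) log n` this error is of order `n⁻²`. Nonnegativity of the mixing density requires
`δ τ³` to be small compared with `ε`, that is `(log n)^(3/2 - (α+1)/2) → 0`, which is where `α > 2`
enters. The decay conditions of the class are upper limits as `t → ∞` for each fixed `f`, so
Gaussian decay makes them hold with limit `0`, whatever the constants in that decay. -/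

/-! ### Le Cam's two-point bound and mixtures with constant `σ`. -/

theorem pi_mono {ι : Type*} [Fintype ι] {X : ι → Type*} [∀ i, MeasurableSpace (X i)]
    {μ ν : ∀ i, Measure (X i)} (h : ∀ i, μ i ≤ ν i) : Measure.pi μ ≤ Measure.pi ν := by
  refine Measure.le_iff.2 fun s hs => ?_
  rw [Measure.pi_def, Measure.pi_def]
  rw [toMeasure_apply _ _ hs, toMeasure_apply _ _ hs]
  refine (OuterMeasure.le_boundedBy.2 fun t => (OuterMeasure.boundedBy_le t).trans ?_) s
  exact Finset.prod_le_prod' fun i _ => h i _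

/-- Le Cam's two-point bound for two measures with a common minorant. -/
theorem two_point_bound {Ω : Type*} [MeasurableSpace Ω] {P Q m : Measure Ω} (hP : m ≤ P)
    (hQ : m ≤ Q) {T : Ω → ℝ} (hT : Measurable T) (a b : ℝ) :
    ENNReal.ofReal ((a - b) ^ 2 / 2) * m Set.univ ≤
      ∫⁻ x, ENNReal.ofReal ((T x - a) ^ 2) ∂P + ∫⁻ x, ENNReal.ofReal ((T x - b) ^ 2) ∂Q := by
  refine le_trans ?_ (add_le_add (lintegral_mono' hP le_rfl) (lintegral_mono' hQ le_rfl))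
  rw [← lintegral_add_left (by fun_prop)]
  rw [← lintegral_const]
  refine lintegral_mono fun x => ?_
  rw [← ENNReal.ofReal_add (sq_nonneg _) (sq_nonneg _)]
  exact ENNReal.ofReal_le_ofReal (by nlinarith [sq_nonneg (T x - a + (T x - b))])

theorem ofReal_integral_le_lintegral_ofReal {Ω : Type*} [MeasurableSpace Ω] {μ : Measure Ω}
    {f : Ω → ℝ} (hf : Integrable f μ) :
    ENNReal.ofReal (∫ x, f x ∂μ) ≤ ∫⁻ x, ENNReal.ofReal (f x) ∂μ := by
  rw [integral_eq_lintegral_pos_part_sub_lintegral_neg_part hf]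
  exact (ENNReal.ofReal_le_ofReal (sub_le_self _ ENNReal.toReal_nonneg)).trans
    ENNReal.ofReal_toReal_le

/-- The eligible mixture in which `σ = σ₀` almost surely and `u` has the density `k`, the same for
every `σ`. -/
def EligibleMixture.ofDensity (u₀ σ₀ ε : ℝ) (k : ℝ → ℝ) (hσ : 0 < σ₀) (hε0 : 0 < ε) (hε1 : ε < 1)
    (hk : Measurable k) (hk0 : ∀ u, 0 ≤ k u) (hki : Integrable k) (hk1 : ∫ u, k u = 1) :
    EligibleMixture :=
  have hprob : IsProbabilityMeasure (volume.withDensity fun u => ENNReal.ofReal (k u)) := by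
    refine ⟨?_⟩
    rw [withDensity_apply _ MeasurableSet.univ, Measure.restrict_univ,
      ← ofReal_integral_eq_lintegral_ofReal hki (Eventually.of_forall hk0), hk1,
      ENNReal.ofReal_one]
  have hsnd : ((volume.withDensity fun u => ENNReal.ofReal (k u)).prod
      (Measure.dirac σ₀)).snd = Measure.dirac σ₀ := Measure.snd_prod
  { u₀ := u₀
    σ₀ := σ₀
    ε := ε
    H := (volume.withDensity fun u => ENNReal.ofReal (k u)).prod (Measure.dirac σ₀)
    h := fun _ u => k u
    σ₀_pos := hσ
    ε_pos := hε0
    ε_lt_one := hε1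
    isProbabilityMeasure_H := inferInstance
    support_H := by rw [hsnd]; simp
    measurable_h := hk.comp measurable_snd
    h_nonneg := fun _ _ => hk0
    integrable_h := fun _ _ => hki
    integral_h := fun _ _ => hk1
    disintegration := by
      rw [hsnd, prod_withDensity_left]
      exact hk.ennreal_ofReal }

theorem EligibleMixture.density_ofDensity {u₀ σ₀ ε : ℝ} {k : ℝ → ℝ} (hσ : 0 < σ₀) (hε0 : 0 < ε)
    (hε1 : ε < 1) (hk : Measurable k) (hk0 : ∀ u, 0 ≤ k u) (hki : Integrable k)
    (hk1 : ∫ u, k u = 1) (x : ℝ) :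
    (EligibleMixture.ofDensity u₀ σ₀ ε k hσ hε0 hε1 hk hk0 hki hk1).density x =
      (1 - ε) * (1 / σ₀ * gaussianPDFReal 0 1 ((x - u₀) / σ₀)) +
        ε * ∫ u, k u * (1 / σ₀ * gaussianPDFReal 0 1 ((x - u) / σ₀)) := by
  unfold EligibleMixture.density EligibleMixture.ofDensity
  congr 2
  simp only
  rw [Measure.prod_dirac, integral_map (by fun_prop), integral_withDensity_eq_integral_toReal_smul]
  · refine integral_congr_ae (Eventually.of_forall fun u => ?_)
    simp [ENNReal.toReal_ofReal (hk0 u)]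
  · exact hk.ennreal_ofReal
  · simp
  · apply Measurable.aestronglyMeasurable
    fun_prop

/-- Two members of the parameter space whose densities differ by at most `1 / n` in `L¹` bound the
minimax risk from below. -/
theorem minimaxRisk_ge {θ : EligibleMixture → ℝ} {α β ε₀ q a A : ℝ} {n : ℕ} (hn : n ≠ 0)
    {M N : EligibleMixture} (hM : MemF₀ α β ε₀ q a A n M) (hN : MemF₀ α β ε₀ q a A n N)
    (hMm : Integrable M.density) (hNm : Integrable N.density)
    (hM1 : ∫ x, M.density x = 1)
    (hd : ∫ x, |M.density x - N.density x| ≤ 1 / (2 * n)) :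
    ENNReal.ofReal ((θ M - θ N) ^ 2 / 8) ≤ minimaxRisk θ α β ε₀ q a A n := by
  have hn0 : (0 : ℝ) < n := by positivity
  refine le_iInf₂ fun T hT => ?_
  set S := ⨆ (M : EligibleMixture) (_ : MemF₀ α β ε₀ q a A n M),
      ∫⁻ x, ENNReal.ofReal ((T x - θ M) ^ 2) ∂(M.sampleLaw n) with hS
  have h1 : ∫⁻ x, ENNReal.ofReal ((T x - θ M) ^ 2) ∂(M.sampleLaw n) ≤ S := le_iSup₂_of_le M hM le_rfl
  have h2 : ∫⁻ x, ENNReal.ofReal ((T x - θ N) ^ 2) ∂(N.sampleLaw n) ≤ S := le_iSup₂_of_le N hN le_rfl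
  let m : Measure ℝ := volume.withDensity fun x => ENNReal.ofReal (min (M.density x) (N.density x))
  have hmi : Integrable fun x => min (M.density x) (N.density x) := hMm.inf hNm
  have hmass : ENNReal.ofReal (1 - 1 / (2 * n)) ≤ m Set.univ := by
    simp only [m, withDensity_apply _ MeasurableSet.univ, Measure.restrict_univ]
    refine le_trans (ENNReal.ofReal_le_ofReal ?_) (ofReal_integral_le_lintegral_ofReal hmi)
    -- Pointwise `f - |f - g| ≤ min f g`, so the common part has mass at least `1 - ‖f - g‖₁`.
    have := integral_mono (hMm.sub (hMm.sub hNm).abs) hmi (fun x => ?_)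
    · simp only [Pi.sub_apply] at this
      rw [integral_sub hMm (by simpa using (hMm.sub hNm).abs), hM1] at this
      linarith
    · simp only [Pi.sub_apply]
      rcases le_total (M.density x) (N.density x) with h | h
      · rw [min_eq_left h]; linarith [abs_nonneg (M.density x - N.density x)]
      · rw [min_eq_right h]; linarith [le_abs_self (M.density x - N.density x)]
  have hfin : IsFiniteMeasure m := isFiniteMeasure_withDensity_ofReal hmi.2
  have hpi : ENNReal.ofReal (1 / 2) ≤ (Measure.pi fun _ : Fin n => m) Set.univ := by
    rw [Measure.pi_univ, Finset.prod_const, Finset.card_univ, Fintype.card_fin]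
    refine le_trans ?_ (pow_le_pow_left' hmass n)
    have h0 : (0 : ℝ) ≤ 1 - 1 / (2 * n) := by
      have : (1 : ℝ) ≤ n := by exact_mod_cast Nat.one_le_iff_ne_zero.2 hn
      rw [sub_nonneg, div_le_one (by positivity)]
      linarith
    rw [← ENNReal.ofReal_pow h0]
    refine ENNReal.ofReal_le_ofReal ?_
    -- Bernoulli's inequality: `(1 - 1/(2n))^n ≥ 1/2`.
    have := one_add_mul_le_pow (a := -(1 / (2 * (n : ℝ)))) (by linarith) n
    have h3 : (n : ℝ) * (1 / (2 * n)) = 1 / 2 := by field_simp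
    have h4 : 1 + (n : ℝ) * -(1 / (2 * n)) = 1 / 2 := by rw [mul_neg, h3]; norm_num
    rw [h4] at this
    simpa [sub_eq_add_neg] using this
  have hPm : (Measure.pi fun _ : Fin n => m) ≤ M.sampleLaw n :=
    pi_mono fun _ => withDensity_mono (Eventually.of_forall fun x =>
      ENNReal.ofReal_le_ofReal (min_le_left _ _))
  have hQm : (Measure.pi fun _ : Fin n => m) ≤ N.sampleLaw n :=
    pi_mono fun _ => withDensity_mono (Eventually.of_forall fun x =>
      ENNReal.ofReal_le_ofReal (min_le_right _ _))
  have key := (two_point_bound hPm hQm hT (θ M) (θ N)).trans (add_le_add h1 h2)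
  -- The `8` collects three factors `2`: the two-point inequality, the mass `1/2` of the common
  -- part, and the sum of two risks.
  have key2 : ENNReal.ofReal ((θ M - θ N) ^ 2 / 8) * 2 ≤ S * 2 := by
    rw [mul_two S]
    refine le_trans ?_ ((mul_le_mul_right hpi _).trans key)
    rw [← ENNReal.ofReal_mul (by positivity)]
    have : (2 : ENNReal) = ENNReal.ofReal 2 := by simp
    rw [this, ← ENNReal.ofReal_mul (by positivity)]
    refine ENNReal.ofReal_le_ofReal ?_
    ring_nf; exact le_rfl
  exact (ENNReal.mul_le_mul_iff_left (by simp) (by simp)).1 key2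

/-! ### Gaussian densities: Fourier transforms, products, convolutions. -/

/-- The density of the centered Gaussian distribution with variance `v`. -/
def gaussDens (v x : ℝ) : ℝ := (√(2 * Real.pi * v))⁻¹ * Real.exp (-x ^ 2 / (2 * v))

theorem gaussianPDFReal_eq_gaussDens (m : ℝ) {v : ℝ} (hv : 0 ≤ v) (x : ℝ) :
    gaussianPDFReal m v.toNNReal x = gaussDens v (x - m) := by
  simp [gaussianPDFReal, gaussDens, Real.coe_toNNReal v hv]

theorem gaussDens_nonneg (v x : ℝ) : 0 ≤ gaussDens v x := by unfold gaussDens; positivity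

@[fun_prop]
theorem continuous_gaussDens (v : ℝ) : Continuous (gaussDens v) := by
  unfold gaussDens; fun_prop

theorem integrable_gaussDens {v : ℝ} (hv : 0 ≤ v) : Integrable (gaussDens v) := by
  have := integrable_gaussianPDFReal 0 v.toNNReal
  simpa [funext (gaussianPDFReal_eq_gaussDens 0 hv)] using this

theorem integral_gaussDens {v : ℝ} (hv : 0 < v) : ∫ x, gaussDens v x = 1 := by
  have := integral_gaussianPDFReal_eq_one 0 (v := v.toNNReal) (by simpa using hv)
  simpa [gaussianPDFReal_eq_gaussDens 0 hv.le] using this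

theorem scaled_gaussianPDFReal {σ : ℝ} (hσ : 0 < σ) (x : ℝ) :
    1 / σ * gaussianPDFReal 0 1 (x / σ) = gaussDens (σ ^ 2) x := by
  have h : √(2 * Real.pi * σ ^ 2) = √(2 * Real.pi) * σ := by
    rw [Real.sqrt_mul (by positivity), Real.sqrt_sq hσ.le]
  simp only [gaussianPDFReal, gaussDens, h, sub_zero, NNReal.coe_one, mul_one]
  field_simp

/-- The characteristic function of a Gaussian density with mean `m`. -/
theorem integral_cexp_mul_gaussDens {v : ℝ} (hv : 0 < v) (m t : ℝ) :
    ∫ x : ℝ, Complex.exp (Complex.I * t * x) * (gaussDens v (x - m) : ℂ) =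
      Complex.exp (Complex.I * t * m) * (Real.exp (-v * t ^ 2 / 2) : ℝ) := by
  have h := charFun_gaussianReal (μ := m) (v := v.toNNReal) t
  rw [charFun_apply_real, integral_gaussianReal_eq_integral_smul (by simpa using hv)] at h
  push_cast
  rw [← Complex.exp_add]
  convert h using 2
  · ext x
    rw [gaussianPDFReal_eq_gaussDens m hv.le, Complex.real_smul, mul_comm]
    congr 2
    ring
  · rw [Real.coe_toNNReal v hv.le]
    ring_nf

theorem integrable_gaussDens_sub {v : ℝ} (hv : 0 ≤ v) (m : ℝ) :
    Integrable fun x => gaussDens v (x - m) := (integrable_gaussDens hv).comp_sub_right m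

theorem integral_gaussDens_mul_cos {v : ℝ} (hv : 0 < v) (m s d : ℝ) :
    ∫ y, gaussDens v (y - m) * Real.cos (s * (y - d)) =
      Real.exp (-v * s ^ 2 / 2) * Real.cos (s * (m - d)) := by
  have h := congrArg (fun z => (Complex.exp (-Complex.I * s * d) * z).re)
    (integral_cexp_mul_gaussDens hv m s)
  simp only [← integral_const_mul, ← mul_assoc, ← Complex.exp_add] at h
  have e : ∀ y : ℝ, -Complex.I * s * d + Complex.I * s * y = ((s * (y - d) : ℝ) : ℂ) * Complex.I := by
    intro y; push_cast; ring
  simp only [e] at h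
  rw [← RCLike.re_eq_complex_re, ← integral_re] at h
  · simp only [RCLike.re_eq_complex_re, Complex.re_mul_ofReal, Complex.exp_ofReal_mul_I_re] at h
    rw [mul_comm (Real.exp _), ← h]
    exact integral_congr_ae (Eventually.of_forall fun y => mul_comm _ _)
  · refine ((integrable_gaussDens_sub hv.le m).ofReal (𝕜 := ℂ)).bdd_mul (c := 1)
      (by fun_prop) (Eventually.of_forall fun y => ?_)
    rw [Complex.norm_exp_ofReal_mul_I]

/-- Completing the square in `y`. The case `w = 1/2`, where the weight is `exp(-y²)`, is the source
of `envelope` and of the variance `r = (v/2)/(1/2 + v)`. -/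
theorem gaussDens_mul_exp {v w : ℝ} (hv : 0 < v) (hw : 0 < w) (x y : ℝ) :
    gaussDens v (x - y) * Real.exp (-y ^ 2 / (2 * w)) =
      √(w / (w + v)) * Real.exp (-x ^ 2 / (2 * (w + v))) *
        gaussDens (w * v / (w + v)) (y - w / (w + v) * x) := by
  have h1 : (√(2 * Real.pi * v))⁻¹ = √(w / (w + v)) * (√(2 * Real.pi * (w * v / (w + v))))⁻¹ := by
    rw [← Real.sqrt_inv, ← Real.sqrt_inv, ← Real.sqrt_mul (by positivity)]
    congr 1
    field_simp
  unfold gaussDens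
  rw [h1]
  have h2 : Real.exp (-(x - y) ^ 2 / (2 * v)) * Real.exp (-y ^ 2 / (2 * w)) =
      Real.exp (-x ^ 2 / (2 * (w + v))) *
        Real.exp (-(y - w / (w + v) * x) ^ 2 / (2 * (w * v / (w + v)))) := by
    rw [← Real.exp_add, ← Real.exp_add]
    congr 1
    field_simp
    ring
  linear_combination √(w / (w + v)) * (√(2 * Real.pi * (w * v / (w + v))))⁻¹ * h2

theorem integral_gaussDens_mul_gaussDens {v w : ℝ} (hv : 0 < v) (hw : 0 < w) (x : ℝ) :
    ∫ y, gaussDens v (x - y) * gaussDens w y = gaussDens (v + w) x := by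
  have h : ∀ y, gaussDens v (x - y) * gaussDens w y =
      gaussDens (v + w) x * gaussDens (w * v / (w + v)) (y - w / (w + v) * x) := by
    intro y
    have h0 := gaussDens_mul_exp hv hw x y
    have h1 : (√(2 * Real.pi * w))⁻¹ * √(w / (w + v)) = (√(2 * Real.pi * (v + w)))⁻¹ := by
      rw [← Real.sqrt_inv, ← Real.sqrt_inv, ← Real.sqrt_mul (by positivity)]
      congr 1
      field_simp
      ring
    rw [show gaussDens w y = (√(2 * Real.pi * w))⁻¹ * Real.exp (-y ^ 2 / (2 * w)) from rfl,
      mul_left_comm, h0, ← mul_assoc, ← mul_assoc, h1, add_comm w v]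
    rfl
  simp_rw [h]
  rw [integral_const_mul, integral_sub_right_eq_self (fun y => gaussDens (w * v / (w + v)) y),
    integral_gaussDens (by positivity), mul_one]

theorem integrable_exp_neg_mul_sq_mul_cos {R : ℝ} (hR : 0 < R) (z : ℝ) :
    Integrable fun s : ℝ => Real.exp (-R * s ^ 2) * Real.cos (s * z) := by
  refine (integrable_exp_neg_mul_sq hR).mul_bdd (c := 1) (by fun_prop)
    (Eventually.of_forall fun s => ?_)
  rw [Real.norm_eq_abs]
  exact Real.abs_cos_le_one _

/-- Fourier inversion for a Gaussian, read off from the transform of the Gaussian with the inverse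
variance. -/
theorem integral_exp_mul_cos {R : ℝ} (hR : 0 < R) (z : ℝ) :
    (2 * Real.pi)⁻¹ * ∫ s : ℝ, Real.exp (-R / 2 * s ^ 2) * Real.cos (s * z) = gaussDens R z := by
  have h := integral_gaussDens_mul_cos (inv_pos.2 hR) 0 z 0
  have h1 : ∀ s : ℝ, Real.exp (-R / 2 * s ^ 2) * Real.cos (s * z) =
      √(2 * Real.pi * R⁻¹) * (gaussDens R⁻¹ (s - 0) * Real.cos (z * (s - 0))) := by
    intro s
    have : √(2 * Real.pi * R⁻¹) ≠ 0 := by positivity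
    unfold gaussDens
    rw [sub_zero, mul_comm s z, ← mul_assoc, ← mul_assoc, mul_inv_cancel₀ this, one_mul]
    congr 2
    field_simp
  simp_rw [h1]
  rw [integral_const_mul, h]
  unfold gaussDens
  have h2 : (2 * Real.pi)⁻¹ * √(2 * Real.pi * R⁻¹) = (√(2 * Real.pi * R))⁻¹ := by
    rw [← Real.sqrt_inv, ← Real.sqrt_sq (show 0 ≤ (2 * Real.pi)⁻¹ by positivity),
      ← Real.sqrt_mul (by positivity)]
    congr 1
    field_simp
  rw [sub_zero, mul_zero, Real.cos_zero, mul_one, ← mul_assoc, h2]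
  congr 2
  field_simp

/-! ### Band-limited kernels and their truncation error. -/

/-- A Gaussian weight times a band-limited oscillating kernel. -/
def cosKernel (l d τ y : ℝ) : ℝ :=
  (2 * Real.pi)⁻¹ * Real.exp (-y ^ 2) *
    ∫ s in -τ..τ, Real.exp (-l * s ^ 2) * Real.cos (s * (y - d))

theorem continuous_cosKernel (l d τ : ℝ) : Continuous (cosKernel l d τ) := by
  unfold cosKernel
  refine Continuous.mul (by fun_prop) ?_
  exact intervalIntegral.continuous_parametric_intervalIntegral_of_continuous' (by fun_prop) _ _

theorem integrable_exp_neg_sq : Integrable fun y : ℝ => Real.exp (-y ^ 2) := by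
  simpa using integrable_exp_neg_mul_sq one_pos

/-- Fubini. The vector-valued form serves both a translated Gaussian `ψ`, for the convolution, and
`ψ y = exp(ity)`, for the characteristic function. -/
theorem integral_cosKernel_smul {E : Type*} [NormedAddCommGroup E] [NormedSpace ℝ E] [CompleteSpace E]
    {l d τ : ℝ} (hl : 0 ≤ l) (hτ : 0 ≤ τ) {ψ : ℝ → E} (hψ : Continuous ψ) {B : ℝ}
    (hB : ∀ y, ‖ψ y‖ ≤ B) :
    ∫ y, cosKernel l d τ y • ψ y = ∫ s in -τ..τ,
      ((2 * Real.pi)⁻¹ * Real.exp (-l * s ^ 2)) •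
        ∫ y, (Real.exp (-y ^ 2) * Real.cos (s * (y - d))) • ψ y := by
  have hττ : -τ ≤ τ := by linarith
  let F : ℝ → ℝ → E := fun y s =>
    ((2 * Real.pi)⁻¹ * Real.exp (-l * s ^ 2) * (Real.exp (-y ^ 2) * Real.cos (s * (y - d)))) • ψ y
  have hF : Continuous (Function.uncurry F) := by
    simp only [F, Function.uncurry_def]; fun_prop
  have hint : Integrable (Function.uncurry F)
      (volume.prod (volume.restrict (Set.Ioc (-τ) τ))) := by
    have h1 : Integrable (fun _ : ℝ => (2 * Real.pi)⁻¹) (volume.restrict (Set.Ioc (-τ) τ)) :=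
      integrable_const _
    refine ((integrable_exp_neg_sq.mul_const B).mul_prod h1).mono'
      hF.aestronglyMeasurable (Eventually.of_forall fun z => ?_)
    simp only [F, Function.uncurry_def, norm_smul, Real.norm_eq_abs, abs_mul, Real.abs_exp]
    rw [abs_of_pos (show 0 < (2 * Real.pi)⁻¹ by positivity)]
    have e1 : Real.exp (-l * z.2 ^ 2) ≤ 1 := Real.exp_le_one_iff.2 (by nlinarith [sq_nonneg z.2])
    have e2 := Real.abs_cos_le_one (z.2 * (z.1 - d))
    have e3 := hB z.1
    have e4 : (2 * Real.pi)⁻¹ * Real.exp (-l * z.2 ^ 2) ≤ (2 * Real.pi)⁻¹ * 1 := by gcongr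
    have e5 : Real.exp (-z.1 ^ 2) * |Real.cos (z.2 * (z.1 - d))| ≤ Real.exp (-z.1 ^ 2) * 1 := by
      gcongr
    calc _ ≤ (2 * Real.pi)⁻¹ * 1 * (Real.exp (-z.1 ^ 2) * 1) * B := by gcongr
      _ = _ := by ring
  have h1 : ∀ y, cosKernel l d τ y • ψ y = ∫ s in Set.Ioc (-τ) τ, F y s := by
    intro y
    simp only [F, cosKernel]
    rw [integral_smul_const, intervalIntegral.integral_of_le hττ, ← integral_const_mul]
    congr 1
    refine integral_congr_ae (Eventually.of_forall fun s => ?_)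
    ring
  simp_rw [h1]
  rw [integral_integral_swap hint, intervalIntegral.integral_of_le hττ]
  refine integral_congr_ae (Eventually.of_forall fun s => ?_)
  simp only [F]
  rw [← integral_smul]
  simp only [smul_smul]

/-- The Gaussian envelope of `gaussDens v` convolved with `cosKernel`. -/
def envelope (v x : ℝ) : ℝ := √((1 / 2) / (1 / 2 + v)) * Real.exp (-x ^ 2 / (2 * (1 / 2 + v)))

theorem integral_gaussDens_mul_exp_cos {v : ℝ} (hv : 0 < v) (x s d : ℝ) :
    ∫ y, Real.exp (-y ^ 2) * Real.cos (s * (y - d)) * gaussDens v (x - y) =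
      envelope v x * (Real.exp (-((1 / 2) * v / (1 / 2 + v)) * s ^ 2 / 2) *
        Real.cos (s * ((1 / 2) / (1 / 2 + v) * x - d))) := by
  rw [← integral_gaussDens_mul_cos (by positivity), ← integral_const_mul]
  refine integral_congr_ae (Eventually.of_forall fun y => ?_)
  have h := gaussDens_mul_exp hv (show (0 : ℝ) < 1 / 2 by norm_num) x y
  rw [show -y ^ 2 / (2 * (1 / 2)) = -y ^ 2 by ring] at h
  simp only [envelope]
  linear_combination Real.cos (s * (y - d)) * h

theorem gaussDens_le (v x : ℝ) : gaussDens v x ≤ (√(2 * Real.pi * v))⁻¹ := by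
  unfold gaussDens
  by_cases hv : 0 ≤ v
  · refine mul_le_of_le_one_right (by positivity) (Real.exp_le_one_iff.2 ?_)
    exact div_nonpos_of_nonpos_of_nonneg (by nlinarith [sq_nonneg x]) (by positivity)
  · rw [Real.sqrt_eq_zero_of_nonpos (by nlinarith [Real.pi_pos])]
    simp

theorem norm_gaussDens_le (v x : ℝ) : ‖gaussDens v x‖ ≤ (√(2 * Real.pi * v))⁻¹ := by
  rw [Real.norm_of_nonneg (gaussDens_nonneg _ _)]; exact gaussDens_le v x

/-- Outside the band, half of the exponent `-r s²/2` gives the small factor and the other half is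
integrated. The nonpositive term `-l s²` is dropped, so the bound does not depend on `l`. -/
theorem abs_integral_Ioc_compl_le {r τ : ℝ} (hr : 0 < r) (hτ : 0 ≤ τ) {l : ℝ} (hl : 0 ≤ l) (z : ℝ) :
    |∫ s in (Set.Ioc (-τ) τ)ᶜ, Real.exp (-(2 * l + r) / 2 * s ^ 2) * Real.cos (s * z)| ≤
      Real.exp (-r * τ ^ 2 / 4) * √(Real.pi / (r / 4)) := by
  rw [← integral_gaussian, ← integral_const_mul, ← Real.norm_eq_abs]
  have hi := (integrable_exp_neg_mul_sq (show 0 < r / 4 by positivity)).const_mul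
    (Real.exp (-r * τ ^ 2 / 4))
  refine (norm_integral_le_of_norm_le hi.integrableOn ?_).trans
    (setIntegral_le_integral hi (Eventually.of_forall fun s => by positivity))
  refine (ae_restrict_iff' measurableSet_Ioc.compl).2 (Eventually.of_forall fun s hs => ?_)
  rw [norm_mul, Real.norm_of_nonneg (Real.exp_pos _).le, Real.norm_eq_abs, ← Real.exp_add]
  refine (mul_le_of_le_one_right (Real.exp_pos _).le (Real.abs_cos_le_one _)).trans
    (Real.exp_le_exp.2 ?_)
  have hs2 : τ ^ 2 ≤ s ^ 2 := by
    rw [sq_le_sq, abs_of_nonneg hτ]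
    by_contra! h
    exact hs ⟨(abs_lt.1 h).1, (abs_lt.1 h).2.le⟩
  nlinarith [mul_nonneg hl (sq_nonneg s)]

/-- In the frequency variable the convolution is `envelope` times an integral over `[-τ, τ]`. Over
the whole line that integral is a Gaussian density by Fourier inversion, so the error is the tail
alone. -/
theorem abs_envelope_mul_sub_conv_cosKernel_le {v : ℝ} (hv : 0 < v) {l τ : ℝ} (hl : 0 ≤ l)
    (hτ : 0 ≤ τ) (d x : ℝ) :
    |envelope v x * gaussDens (2 * l + (1 / 2) * v / (1 / 2 + v)) ((1 / 2) / (1 / 2 + v) * x - d) -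
        ∫ y, cosKernel l d τ y * gaussDens v (x - y)| ≤
      envelope v x * (Real.exp (-((1 / 2) * v / (1 / 2 + v)) * τ ^ 2 / 4) *
        √(Real.pi / ((1 / 2) * v / (1 / 2 + v) / 4))) := by
  set r := (1 / 2) * v / (1 / 2 + v) with hr
  have hr0 : 0 < r := by positivity
  set z := (1 / 2) / (1 / 2 + v) * x - d
  have hE : 0 ≤ envelope v x := by unfold envelope; positivity
  have hττ : -τ ≤ τ := by linarith
  have h1 : ∫ y, cosKernel l d τ y * gaussDens v (x - y) = envelope v x * ((2 * Real.pi)⁻¹ *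
      ∫ s in Set.Ioc (-τ) τ, Real.exp (-(2 * l + r) / 2 * s ^ 2) * Real.cos (s * z)) := by
    have := integral_cosKernel_smul (E := ℝ) (d := d) hl hτ (ψ := fun y => gaussDens v (x - y))
      (by fun_prop) (fun y => norm_gaussDens_le v _)
    simp only [smul_eq_mul] at this
    rw [this, intervalIntegral.integral_of_le hττ, ← integral_const_mul, ← integral_const_mul]
    refine integral_congr_ae (Eventually.of_forall fun s => ?_)
    simp only
    rw [integral_gaussDens_mul_exp_cos hv, ← hr,
      show -(2 * l + r) / 2 * s ^ 2 = -l * s ^ 2 + -r * s ^ 2 / 2 by ring, Real.exp_add]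
    ring
  have hR : 0 < 2 * l + r := by positivity
  have hint := integrable_exp_neg_mul_sq_mul_cos (show 0 < (2 * l + r) / 2 by positivity) z
  have e : ∀ s : ℝ, -((2 * l + r) / 2) * s ^ 2 = -(2 * l + r) / 2 * s ^ 2 := fun s => by ring
  simp only [e] at hint
  rw [h1, ← integral_exp_mul_cos hR, ← mul_sub, ← mul_sub, abs_mul, abs_of_nonneg hE,
    ← integral_add_compl (measurableSet_Ioc (a := -τ) (b := τ)) hint, add_sub_cancel_left, abs_mul,
    abs_of_pos (by positivity)]
  refine mul_le_mul_of_nonneg_left ?_ hE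
  refine (mul_le_of_le_one_left (abs_nonneg _) ?_).trans (abs_integral_Ioc_compl_le hr0 hτ hl z)
  exact inv_le_one_of_one_le₀ (by nlinarith [Real.pi_gt_three])

/-- A band-limited kernel `K` such that convolution with it takes the density of `N(0, v)` to
that of `N(d, v + δ)`, up to an error that is exponentially small in `τ ^ 2`. -/
def shiftKernel (d δ τ y : ℝ) : ℝ :=
  √(1 / (1 - 2 * δ)) * Real.exp (1 / (1 - 2 * δ) * d ^ 2) *
    cosKernel (1 / (1 - 2 * δ) * δ / 2) (1 / (1 - 2 * δ) * d) τ y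

/-- This explains the constants in `shiftKernel`. With `ϑ = 1/(1 - 2δ)` and `δ > 0`, the density of
`N(d, δ)` is `√ϑ exp(ϑ d²) exp(-y²)` times the density of `N(ϑd, ϑδ)`; the lemma is this identity
convolved with `N(0, v)`, a form that also covers `δ = 0`. -/
theorem envelope_mul_gaussDens {v δ : ℝ} (hv : 0 < v) (hδ : 0 ≤ δ) (hδ1 : δ < 1 / 2) (d x : ℝ) :
    √(1 / (1 - 2 * δ)) * Real.exp (1 / (1 - 2 * δ) * d ^ 2) * (envelope v x *
      gaussDens (2 * (1 / (1 - 2 * δ) * δ / 2) + (1 / 2) * v / (1 / 2 + v))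
        ((1 / 2) / (1 / 2 + v) * x - 1 / (1 - 2 * δ) * d)) = gaussDens (v + δ) (x - d) := by
  have h1 : 0 < 1 - 2 * δ := by linarith
  have hR : 0 < 2 * (1 / (1 - 2 * δ) * δ / 2) + (1 / 2) * v / (1 / 2 + v) := by positivity
  have hRe : 2 * (1 / (1 - 2 * δ) * δ / 2) + (1 / 2) * v / (1 / 2 + v) =
      (v + δ) / ((1 + 2 * v) * (1 - 2 * δ)) := by
    field_simp
    ring
  rw [hRe]
  have hs : √(1 / (1 - 2 * δ)) * √((1 / 2) / (1 / 2 + v)) *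
      (√(2 * Real.pi * ((v + δ) / ((1 + 2 * v) * (1 - 2 * δ)))))⁻¹ =
        (√(2 * Real.pi * (v + δ)))⁻¹ := by
    rw [← Real.sqrt_inv, ← Real.sqrt_inv, ← Real.sqrt_mul (by positivity),
      ← Real.sqrt_mul (by positivity)]
    congr 1
    field_simp
  have he : Real.exp (1 / (1 - 2 * δ) * d ^ 2) * Real.exp (-x ^ 2 / (2 * (1 / 2 + v))) *
      Real.exp (-((1 / 2) / (1 / 2 + v) * x - 1 / (1 - 2 * δ) * d) ^ 2 /
        (2 * ((v + δ) / ((1 + 2 * v) * (1 - 2 * δ))))) =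
      Real.exp (-(x - d) ^ 2 / (2 * (v + δ))) := by
    rw [← Real.exp_add, ← Real.exp_add]
    congr 1
    have : 0 < v + δ := by positivity
    field_simp
    ring
  unfold envelope gaussDens
  rw [← hs, ← he]
  ring

theorem abs_gaussDens_sub_conv_shiftKernel_le {v δ τ : ℝ} (hv : 0 < v) (hδ : 0 ≤ δ)
    (hδ1 : δ < 1 / 2) (hτ : 0 ≤ τ) (d x : ℝ) :
    |gaussDens (v + δ) (x - d) - ∫ y, shiftKernel d δ τ y * gaussDens v (x - y)| ≤
      √(1 / (1 - 2 * δ)) * Real.exp (1 / (1 - 2 * δ) * d ^ 2) * (envelope v x *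
        (Real.exp (-((1 / 2) * v / (1 / 2 + v)) * τ ^ 2 / 4) *
          √(Real.pi / ((1 / 2) * v / (1 / 2 + v) / 4)))) := by
  have h1 : 0 < 1 - 2 * δ := by linarith
  rw [← envelope_mul_gaussDens hv hδ hδ1]
  simp only [shiftKernel, mul_assoc (√(1 / (1 - 2 * δ)) * Real.exp (1 / (1 - 2 * δ) * d ^ 2))]
  rw [integral_const_mul, ← mul_sub, abs_mul, abs_of_nonneg (by positivity)]
  exact mul_le_mul_of_nonneg_left
    (abs_envelope_mul_sub_conv_cosKernel_le hv (by positivity) hτ _ x) (by positivity)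

theorem sqrt_mul_exp_le {δ : ℝ} (hδ : 0 ≤ δ) (hδ1 : δ ≤ 1 / 4) :
    √(1 / (1 - 2 * δ)) * Real.exp (1 / (1 - 2 * δ) * δ ^ 2) ≤ 1 + 6 * δ := by
  have h1 : 0 < 1 - 2 * δ := by linarith
  have hϑ : 1 / (1 - 2 * δ) ≤ 1 + 4 * δ := by
    rw [div_le_iff₀ h1]; nlinarith
  have hs : √(1 / (1 - 2 * δ)) ≤ 1 + 4 * δ :=
    (Real.sqrt_le_sqrt hϑ).trans ((Real.sqrt_le_left (by positivity)).2 (by nlinarith))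
  have hx : 1 / (1 - 2 * δ) * δ ^ 2 ≤ δ / 2 := by
    have : 1 / (1 - 2 * δ) * δ ^ 2 ≤ 2 * δ ^ 2 :=
      mul_le_mul_of_nonneg_right (by linarith) (sq_nonneg _)
    nlinarith
  have he : Real.exp (1 / (1 - 2 * δ) * δ ^ 2) ≤ 1 + δ := by
    refine (Real.exp_le_exp.2 hx).trans ?_
    have h2 := Real.abs_exp_sub_one_le (x := δ / 2) (by rw [abs_of_nonneg] <;> linarith)
    rw [abs_of_nonneg (show 0 ≤ δ / 2 by linarith)] at h2
    linarith [le_abs_self (Real.exp (δ / 2) - 1)]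
  calc _ ≤ (1 + 4 * δ) * (1 + δ) := by gcongr
    _ ≤ _ := by nlinarith

theorem one_le_sqrt_mul_exp {δ : ℝ} (hδ : 0 ≤ δ) (hδ1 : δ ≤ 1 / 4) :
    1 ≤ √(1 / (1 - 2 * δ)) * Real.exp (1 / (1 - 2 * δ) * δ ^ 2) := by
  have h1 : 0 < 1 - 2 * δ := by linarith
  refine one_le_mul_of_one_le_of_one_le (Real.one_le_sqrt.2 ?_) (Real.one_le_exp (by positivity))
  rw [le_div_iff₀ h1]; linarith

theorem continuous_shiftKernel (d δ τ : ℝ) : Continuous (shiftKernel d δ τ) := by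
  unfold shiftKernel; exact (continuous_cosKernel _ _ _).const_mul _

/-- The two Fourier integrands are compared on the band: the prefactor changes by at most `6δ`, the
Gaussian factor by `δτ²` and the cosine by `2δτ`, in total at most `9δτ²`. The band has length `2τ`,
whence `τ³`. -/
theorem abs_shiftKernel_sub_le {δ τ : ℝ} (hδ : 0 ≤ δ) (hδ1 : δ ≤ 1 / 4) (hτ : 1 ≤ τ) (y : ℝ) :
    |shiftKernel δ δ τ y - shiftKernel 0 0 τ y| ≤ 3 * δ * τ ^ 3 * Real.exp (-y ^ 2) := by
  have h1 : 0 < 1 - 2 * δ := by linarith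
  set c := √(1 / (1 - 2 * δ)) * Real.exp (1 / (1 - 2 * δ) * δ ^ 2) with hc
  have hc1 := sqrt_mul_exp_le hδ hδ1
  have hc0 := one_le_sqrt_mul_exp hδ hδ1
  rw [← hc] at hc1 hc0
  have hϑ : 1 / (1 - 2 * δ) ≤ 2 := by rw [div_le_iff₀ h1]; linarith
  have hϑ0 : 0 < 1 / (1 - 2 * δ) := by positivity
  set ϑ := 1 / (1 - 2 * δ)
  have h0 : shiftKernel 0 0 τ y = (2 * Real.pi)⁻¹ * Real.exp (-y ^ 2) *
      ∫ s in -τ..τ, Real.cos (s * y) := by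
    simp [shiftKernel, cosKernel]
  have hd : shiftKernel δ δ τ y - shiftKernel 0 0 τ y = (2 * Real.pi)⁻¹ * Real.exp (-y ^ 2) *
      ∫ s in -τ..τ, (c * (Real.exp (-(ϑ * δ / 2) * s ^ 2) * Real.cos (s * (y - ϑ * δ))) -
        Real.cos (s * y)) := by
    rw [intervalIntegral.integral_sub, intervalIntegral.integral_const_mul, h0]
    · unfold shiftKernel cosKernel
      rw [← hc]
      ring
    · exact Continuous.intervalIntegrable (by fun_prop) _ _
    · exact Continuous.intervalIntegrable (by fun_prop) _ _
  have hb : ∀ s ∈ Set.uIoc (-τ) τ, ‖c * (Real.exp (-(ϑ * δ / 2) * s ^ 2) *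
      Real.cos (s * (y - ϑ * δ))) - Real.cos (s * y)‖ ≤ 9 * δ * τ ^ 2 := by
    intro s hs
    rw [Set.uIoc_of_le (by linarith)] at hs
    have hsτ : |s| ≤ τ := abs_le.2 ⟨hs.1.le, hs.2⟩
    have hs2 : s ^ 2 ≤ τ ^ 2 := by rw [← sq_abs s]; gcongr
    set E := Real.exp (-(ϑ * δ / 2) * s ^ 2)
    set C₁ := Real.cos (s * (y - ϑ * δ))
    set C₂ := Real.cos (s * y)
    have hϑδ : ϑ * δ ≤ 2 * δ := mul_le_mul_of_nonneg_right hϑ hδ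
    have hE1 : E ≤ 1 := Real.exp_le_one_iff.2 (by
      have : 0 ≤ ϑ * δ / 2 * s ^ 2 := by positivity
      linarith)
    have hE0 : 0 < E := Real.exp_pos _
    have hE2 : 1 - E ≤ δ * τ ^ 2 := by
      have := Real.add_one_le_exp (-(ϑ * δ / 2) * s ^ 2)
      have h3 : ϑ * δ / 2 * s ^ 2 ≤ δ * τ ^ 2 := by gcongr; linarith
      change _ ≤ E at this
      linarith
    have hC1 : |C₁| ≤ 1 := Real.abs_cos_le_one _
    have hC : |C₁ - C₂| ≤ 2 * δ * τ := by
      have h4 := Real.abs_cos_sub_cos_le (s * (y - ϑ * δ)) (s * y)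
      refine h4.trans ?_
      rw [show s * (y - ϑ * δ) - s * y = -(s * (ϑ * δ)) by ring, abs_neg, abs_mul,
        abs_of_nonneg (show 0 ≤ ϑ * δ by positivity)]
      calc _ ≤ τ * (2 * δ) := by gcongr
        _ = _ := by ring
    rw [Real.norm_eq_abs,
      show c * (E * C₁) - C₂ = (c - 1) * (E * C₁) + ((E - 1) * C₁ + (C₁ - C₂)) by ring]
    have a1 : |(c - 1) * (E * C₁)| ≤ 6 * δ := by
      rw [abs_mul, abs_mul, abs_of_nonneg (show 0 ≤ c - 1 by linarith), abs_of_pos hE0]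
      calc _ ≤ (6 * δ) * (1 * 1) := by gcongr; linarith
        _ = _ := by ring
    have a2 : |(E - 1) * C₁| ≤ δ * τ ^ 2 := by
      rw [abs_mul, abs_sub_comm, abs_of_nonneg (show 0 ≤ 1 - E by linarith)]
      calc _ ≤ (δ * τ ^ 2) * 1 := by gcongr
        _ = _ := by ring
    have a3 : τ ≤ τ ^ 2 := by nlinarith
    have a4 : δ ≤ δ * τ ^ 2 := by nlinarith
    have a5 : δ * τ ≤ δ * τ ^ 2 := by gcongr
    calc _ ≤ 6 * δ + (δ * τ ^ 2 + 2 * δ * τ) :=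
          (abs_add_le _ _).trans (add_le_add a1 ((abs_add_le _ _).trans (add_le_add a2 hC)))
      _ ≤ _ := by nlinarith
  have hI := intervalIntegral.norm_integral_le_of_norm_le_const hb
  rw [hd, abs_mul, abs_of_pos (by positivity)]
  rw [Real.norm_eq_abs, show τ - -τ = 2 * τ by ring, abs_of_nonneg (by linarith : 0 ≤ 2 * τ)] at hI
  calc _ ≤ (2 * Real.pi)⁻¹ * Real.exp (-y ^ 2) * (9 * δ * τ ^ 2 * (2 * τ)) := by gcongr
    _ = (9 * Real.pi⁻¹) * (δ * τ ^ 3 * Real.exp (-y ^ 2)) := by field_simp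
    _ ≤ 3 * (δ * τ ^ 3 * Real.exp (-y ^ 2)) := by
        refine mul_le_mul_of_nonneg_right ?_ (by positivity)
        rw [← div_eq_mul_inv, div_le_iff₀ Real.pi_pos]
        linarith [Real.pi_gt_three]
    _ = _ := by ring

/-! ### Gaussian decay of characteristic functions and membership in the class. -/

/-- `F` is differentiable, and `F` and its derivative are bounded by `C exp (K t - t² / 4)` on the
positive half-line. -/
def GaussianDecay (F : ℝ → ℂ) : Prop :=
  ∃ F' : ℝ → ℂ, (∀ t, HasDerivAt F (F' t) t) ∧ ∃ C K : ℝ, ∀ t, 0 ≤ t →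
    ‖F t‖ ≤ C * Real.exp (K * t - t ^ 2 / 4) ∧ ‖F' t‖ ≤ C * Real.exp (K * t - t ^ 2 / 4)

theorem GaussianDecay.const_mul {F : ℝ → ℂ} (hF : GaussianDecay F) (c : ℂ) :
    GaussianDecay fun t => c * F t := by
  obtain ⟨F', h1, C, K, h2⟩ := hF
  refine ⟨fun t => c * F' t, fun t => (h1 t).const_mul c, ‖c‖ * C, K, fun t ht => ?_⟩
  simp only [norm_mul, mul_assoc]
  exact ⟨mul_le_mul_of_nonneg_left (h2 t ht).1 (norm_nonneg _),
    mul_le_mul_of_nonneg_left (h2 t ht).2 (norm_nonneg _)⟩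

theorem GaussianDecay.add {F G : ℝ → ℂ} (hF : GaussianDecay F) (hG : GaussianDecay G) :
    GaussianDecay fun t => F t + G t := by
  obtain ⟨F', h1, C, K, h2⟩ := hF
  obtain ⟨G', h3, D, L, h4⟩ := hG
  have hC : 0 ≤ C := by simpa using (norm_nonneg _).trans (h2 0 le_rfl).1
  have hD : 0 ≤ D := by simpa using (norm_nonneg _).trans (h4 0 le_rfl).1
  refine ⟨fun t => F' t + G' t, fun t => (h1 t).add (h3 t), C + D, max K L, fun t ht => ?_⟩
  have e1 : Real.exp (K * t - t ^ 2 / 4) ≤ Real.exp (max K L * t - t ^ 2 / 4) := by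
    gcongr; exact le_max_left _ _
  have e2 : Real.exp (L * t - t ^ 2 / 4) ≤ Real.exp (max K L * t - t ^ 2 / 4) := by
    gcongr; exact le_max_right _ _
  have e3 := mul_le_mul_of_nonneg_left e1 hC
  have e4 := mul_le_mul_of_nonneg_left e2 hD
  rw [add_mul]
  exact ⟨(norm_add_le _ _).trans (add_le_add ((h2 t ht).1.trans e3) ((h4 t ht).1.trans e4)),
    (norm_add_le _ _).trans (add_le_add ((h2 t ht).2.trans e3) ((h4 t ht).2.trans e4))⟩

theorem GaussianDecay.exp_mul {B B' : ℝ → ℂ} (hB : ∀ t, HasDerivAt B (B' t) t) {C K : ℝ}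
    (h : ∀ t, 0 ≤ t → ‖B t‖ ≤ C * Real.exp (K * t) ∧ ‖B' t‖ ≤ C * Real.exp (K * t)) :
    GaussianDecay fun t => (Real.exp (-t ^ 2 / 4) : ℂ) * B t := by
  have hC : 0 ≤ C := by simpa using (norm_nonneg _).trans (h 0 le_rfl).1
  have hd : ∀ t : ℝ, HasDerivAt (fun t : ℝ => ((Real.exp (-t ^ 2 / 4) : ℝ) : ℂ))
      ((Real.exp (-t ^ 2 / 4) * (-t / 2) : ℝ) : ℂ) t := by
    intro t
    refine HasDerivAt.ofReal_comp ?_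
    exact ((hasDerivAt_pow 2 t).neg.div_const 4).exp.congr_deriv (by simp; ring)
  -- Differentiating `exp(-t²/4)` produces a factor `t/2`, which is absorbed by raising `K` by one
  -- since `t ≤ exp t`.
  refine ⟨_, fun t => (hd t).mul (hB t), 2 * C, K + 1, fun t ht => ?_⟩
  have ht1 : t ≤ Real.exp t := by linarith [Real.add_one_le_exp t]
  have he1 : 1 ≤ Real.exp t := Real.one_le_exp ht
  have hexp : Real.exp ((K + 1) * t - t ^ 2 / 4) =
      Real.exp (-t ^ 2 / 4) * (Real.exp (K * t) * Real.exp t) := by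
    rw [← Real.exp_add, ← Real.exp_add]; ring_nf
  have n1 : ‖((Real.exp (-t ^ 2 / 4) : ℝ) : ℂ)‖ = Real.exp (-t ^ 2 / 4) := by
    rw [Complex.norm_real, Real.norm_of_nonneg (Real.exp_pos _).le]
  have n2 : ‖((Real.exp (-t ^ 2 / 4) * (-t / 2) : ℝ) : ℂ)‖ = Real.exp (-t ^ 2 / 4) * (t / 2) := by
    rw [Complex.norm_real, norm_mul, Real.norm_of_nonneg (Real.exp_pos _).le, Real.norm_eq_abs,
      neg_div 2 t, abs_neg, abs_of_nonneg (by positivity)]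
  obtain ⟨b1, b2⟩ := h t ht
  rw [hexp]
  have hK := Real.exp_pos (K * t)
  have hP := Real.exp_pos (-t ^ 2 / 4)
  constructor
  · rw [norm_mul, n1]
    calc _ ≤ Real.exp (-t ^ 2 / 4) * (C * Real.exp (K * t) * (2 * Real.exp t)) := by
          gcongr; exact b1.trans (le_mul_of_one_le_right (by positivity) (by linarith))
      _ = _ := by ring
  · refine (norm_add_le _ _).trans ?_
    rw [norm_mul, norm_mul, n1, n2]
    calc _ ≤ Real.exp (-t ^ 2 / 4) * (Real.exp t / 2) * (C * Real.exp (K * t)) +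
          Real.exp (-t ^ 2 / 4) * (C * Real.exp (K * t) * Real.exp t) := by
          gcongr
          exact b2.trans (le_mul_of_one_le_right (by positivity) he1)
      _ ≤ _ := by
          have : 0 ≤ Real.exp (-t ^ 2 / 4) * Real.exp t * (C * Real.exp (K * t)) := by positivity
          linarith

/-- Because `s` stays in a bounded band, the integral and its derivative grow at most like `exp(|κ|
τ t)`, which the definition of `GaussianDecay` allows. -/
theorem GaussianDecay.exp_mul_integral {a : ℝ → ℂ} (ha : Continuous a) {τ : ℝ} (hτ : 0 ≤ τ)
    (κ : ℝ) :
    GaussianDecay fun t => (Real.exp (-t ^ 2 / 4) : ℂ) *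
      ∫ s in -τ..τ, a s * (Real.exp (κ * s * t) : ℂ) := by
  have hττ : -τ ≤ τ := by linarith
  obtain ⟨D, hD⟩ := (isCompact_Icc (a := -τ) (b := τ)).exists_bound_of_continuousOn
    ha.continuousOn
  have hD0 : 0 ≤ D := (norm_nonneg _).trans (hD 0 ⟨by linarith, hτ⟩)
  have hs : ∀ s ∈ Set.uIoc (-τ) τ, s ∈ Set.Icc (-τ) τ := fun s h => by
    rw [Set.uIoc_of_le hττ] at h; exact Set.Ioc_subset_Icc_self h
  have hn : ∀ s ∈ Set.uIoc (-τ) τ, ∀ t : ℝ,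
      ‖a s * (Real.exp (κ * s * t) : ℂ)‖ ≤ D * Real.exp (|κ| * τ * |t|) := by
    intro s h t
    rw [norm_mul, Complex.norm_real, Real.norm_of_nonneg (Real.exp_pos _).le]
    have : κ * s * t ≤ |κ| * τ * |t| := by
      refine (le_abs_self _).trans ?_
      rw [abs_mul, abs_mul]
      gcongr
      exact abs_le.2 (hs s h)
    gcongr
    exact hD s (hs s h)
  have hn' : ∀ s ∈ Set.uIoc (-τ) τ, ∀ t : ℝ, ‖a s * ((Real.exp (κ * s * t) * (κ * s) : ℝ) : ℂ)‖ ≤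
      D * (|κ| * τ) * Real.exp (|κ| * τ * |t|) := by
    intro s h t
    push_cast
    rw [← mul_assoc, norm_mul]
    have h1 := hn s h t
    have h2 : ‖((κ : ℂ) * s)‖ ≤ |κ| * τ := by
      rw [norm_mul, Complex.norm_real, Complex.norm_real, Real.norm_eq_abs, Real.norm_eq_abs]
      gcongr
      exact abs_le.2 (hs s h)
    push_cast at h1
    calc _ ≤ D * Real.exp (|κ| * τ * |t|) * (|κ| * τ) := by gcongr
      _ = _ := by ring
  have hder : ∀ t : ℝ, HasDerivAt (fun t : ℝ => ∫ s in -τ..τ, a s * (Real.exp (κ * s * t) : ℂ))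
      (∫ s in -τ..τ, a s * ((Real.exp (κ * s * t) * (κ * s) : ℝ) : ℂ)) t := by
    intro t
    refine (intervalIntegral.hasDerivAt_integral_of_dominated_loc_of_deriv_le
      (Metric.ball_mem_nhds t one_pos)
      (bound := fun _ => D * (|κ| * τ) * Real.exp (|κ| * τ * (|t| + 1)))
      (F' := fun t s => a s * ((Real.exp (κ * s * t) * (κ * s) : ℝ) : ℂ))
      (Eventually.of_forall fun _ => Continuous.aestronglyMeasurable (by fun_prop))
      (Continuous.intervalIntegrable (by fun_prop) _ _)
      (Continuous.aestronglyMeasurable (by fun_prop))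
      (Eventually.of_forall fun s h x hx => ?_) (by simp)
      (Eventually.of_forall fun s h x hx => ?_)).2
    · refine (hn' s h x).trans ?_
      have : |x| ≤ |t| + 1 := by
        have h1 : |x - t| < 1 := by simpa [Real.dist_eq] using hx
        have h2 := abs_sub_abs_le_abs_sub x t
        linarith
      gcongr
    · refine HasDerivAt.const_mul _ (HasDerivAt.ofReal_comp ?_)
      simpa using ((hasDerivAt_id x).const_mul (κ * s)).exp
  refine GaussianDecay.exp_mul hder (C := (D + D * (|κ| * τ)) * (2 * τ)) (K := |κ| * τ)
    fun t ht => ?_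
  have i1 := intervalIntegral.norm_integral_le_of_norm_le_const fun s h => hn s h t
  have i2 := intervalIntegral.norm_integral_le_of_norm_le_const fun s h => hn' s h t
  rw [show τ - -τ = 2 * τ by ring, abs_of_nonneg (show 0 ≤ 2 * τ by positivity),
    abs_of_nonneg ht] at i1 i2
  have p1 : 0 ≤ D * (|κ| * τ) * Real.exp (|κ| * τ * t) * (2 * τ) := by positivity
  have p2 : 0 ≤ D * Real.exp (|κ| * τ * t) * (2 * τ) := by positivity
  exact ⟨by linarith, by linarith⟩

theorem GaussianDecay.tendsto {F : ℝ → ℂ} {C K : ℝ}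
    (h : ∀ t, 0 ≤ t → ‖F t‖ ≤ C * Real.exp (K * t - t ^ 2 / 4)) (m : ℝ) :
    Tendsto (fun t : ℝ => |t| ^ m * ‖F t‖) atTop (nhds 0) := by
  have hC : 0 ≤ C := by simpa using (norm_nonneg _).trans (h 0 le_rfl)
  have h0 := (tendsto_rpow_mul_exp_neg_mul_atTop_nhds_zero m 1 one_pos).const_mul C
  rw [mul_zero] at h0
  refine squeeze_zero' (Eventually.of_forall fun t => by positivity) ?_ h0
  -- Beyond this threshold `K t - t²/4 ≤ -t`.
  filter_upwards [eventually_ge_atTop 0, eventually_ge_atTop (4 * (K + 1))] with t ht0 ht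
  rw [abs_of_nonneg ht0]
  calc _ ≤ t ^ m * (C * Real.exp (-1 * t)) := by
        gcongr
        refine (h t ht0).trans (mul_le_mul_of_nonneg_left (Real.exp_le_exp.2 ?_) hC)
        nlinarith
    _ = _ := by ring

theorem limsup_iSup_ofReal_le {F : ℝ → ℝ → ℝ} {G : ℝ → ℝ} {s : Set ℝ} (h : ∀ σ t, F σ t = G t)
    (hG : Tendsto G atTop (nhds 0)) (b : ENNReal) :
    limsup (fun t : ℝ => ⨆ σ ∈ s, ENNReal.ofReal (F σ t)) atTop ≤ b := by
  have h1 : Tendsto (fun t => ENNReal.ofReal (G t)) atTop (nhds 0) := by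
    simpa using ENNReal.tendsto_ofReal hG
  refine le_trans (limsup_le_limsup (Eventually.of_forall fun t => ?_)) (h1.limsup_eq.le.trans bot_le)
  exact iSup₂_le fun σ _ => by rw [h]

/-- Membership in the parameter space when the characteristic functions of the conditional
densities do not depend on `σ` and have Gaussian decay. -/
theorem MemF₀.of_gaussianDecay {α β ε₀ q a A : ℝ} {n : ℕ} {M : EligibleMixture}
    (ha : a ≤ M.σ₀)
    (hm : ∫⁻ x, ENNReal.ofReal (|x| ^ q * M.density x) ≤ ENNReal.ofReal (A ^ q))
    (hε : M.ε ≤ ε₀ * (n : ℝ) ^ (-β)) {F G : ℝ → ℂ} (hF : GaussianDecay F)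
    (hG : GaussianDecay G) (hMF : ∀ σ t, M.hHat σ t = F t) (hMG : ∀ σ t, M.hTilde σ t = G t) :
    MemF₀ α β ε₀ q a A n M := by
  obtain ⟨F', hF1, C, K, hF2⟩ := hF
  obtain ⟨G', hG1, D, L, hG2⟩ := hG
  have hMG' : ∀ σ, M.hTilde σ = G := fun σ => funext (hMG σ)
  refine ⟨ha, hm, ?_, ?_, ?_, hε⟩
  · exact limsup_iSup_ofReal_le (fun σ t => by rw [hMF])
      (GaussianDecay.tendsto (fun t ht => (hF2 t ht).1) α) _
  · exact Eventually.of_forall fun t σ _ => by rw [hMG']; exact (hG1 t).differentiableAt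
  · exact limsup_iSup_ofReal_le (fun σ t => by rw [hMG', (hG1 t).deriv])
      (GaussianDecay.tendsto (fun t ht => (hG2 t ht).2) (α + 1)) _

theorem gaussianDecay_gaussDens {v : ℝ} (hv : 1 / 2 ≤ v) (m : ℝ) :
    GaussianDecay fun t => ∫ x : ℝ, Complex.exp (Complex.I * t * x) * (gaussDens v (x - m) : ℂ) := by
  have h : ∀ t : ℝ, ∫ x : ℝ, Complex.exp (Complex.I * t * x) * (gaussDens v (x - m) : ℂ) =
      (Real.exp (-t ^ 2 / 4) : ℂ) * Complex.exp (Complex.I * t * m - (v / 2 - 1 / 4) * t ^ 2) := by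
    intro t
    rw [integral_cexp_mul_gaussDens (by linarith)]
    push_cast
    rw [← Complex.exp_add, ← Complex.exp_add]
    ring_nf
  simp_rw [h]
  have hd : ∀ t : ℝ, HasDerivAt
      (fun t : ℝ => Complex.exp (Complex.I * t * m - (v / 2 - 1 / 4) * t ^ 2))
      (Complex.exp (Complex.I * t * m - (v / 2 - 1 / 4) * t ^ 2) *
        (Complex.I * m - (v / 2 - 1 / 4) * (2 * t))) t := by
    intro t
    have h1 : HasDerivAt (fun t : ℝ => (t : ℂ)) 1 t := Complex.ofRealCLM.hasDerivAt
    exact (((h1.const_mul Complex.I).mul_const (m : ℂ)).sub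
      ((h1.pow 2).const_mul ((v : ℂ) / 2 - 1 / 4))).cexp.congr_deriv (by simp)
  have hn : ∀ t : ℝ, ‖Complex.exp (Complex.I * t * m - (v / 2 - 1 / 4) * t ^ 2)‖ ≤ 1 := by
    intro t
    rw [show Complex.I * t * m - (v / 2 - 1 / 4) * t ^ 2 =
      ((-(v / 2 - 1 / 4) * t ^ 2 : ℝ) : ℂ) + ((t * m : ℝ) : ℂ) * Complex.I by push_cast; ring,
      Complex.exp_add, norm_mul, Complex.norm_exp_ofReal_mul_I, mul_one, ← Complex.ofReal_exp,
      Complex.norm_real, Real.norm_of_nonneg (Real.exp_pos _).le]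
    exact Real.exp_le_one_iff.2 (by nlinarith [sq_nonneg t])
  refine GaussianDecay.exp_mul hd (C := 1 + |m| + 2 * (v / 2 - 1 / 4)) (K := 1) fun t ht => ?_
  have ht1 : t ≤ Real.exp t := by linarith [Real.add_one_le_exp t]
  have he1 : 1 ≤ Real.exp t := Real.one_le_exp ht
  have hv' : 0 ≤ v / 2 - 1 / 4 := by linarith
  rw [one_mul]
  refine ⟨(hn t).trans ?_, ?_⟩
  · nlinarith [abs_nonneg m]
  · rw [norm_mul]
    have : ‖Complex.I * m - (v / 2 - 1 / 4) * (2 * t)‖ ≤ |m| + (v / 2 - 1 / 4) * (2 * t) := by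
      refine (norm_sub_le _ _).trans (add_le_add (by simp) (le_of_eq ?_))
      rw [show ((v : ℂ) / 2 - 1 / 4) * (2 * t) = (((v / 2 - 1 / 4) * (2 * t) : ℝ) : ℂ) by
        push_cast; ring, Complex.norm_real, Real.norm_of_nonneg (by positivity)]
    calc _ ≤ 1 * (|m| + (v / 2 - 1 / 4) * (2 * t)) := by gcongr; exact hn t
      _ ≤ _ := by nlinarith [abs_nonneg m]

/-- The cosine shifts the frequency `t` by `±s` in the transform of `exp(-y²)`. Expanding `exp(-(t ±
s)²/4)` isolates `exp(-t²/4)` and leaves a cross term that is only exponential in `t`. -/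
theorem integral_exp_mul_cos_mul_cexp (s d t : ℝ) :
    ∫ y : ℝ, (Real.exp (-y ^ 2) * Real.cos (s * (y - d))) • Complex.exp (Complex.I * t * y) =
      (Real.exp (-t ^ 2 / 4) : ℂ) * ((√Real.pi / 2 * Real.exp (-s ^ 2 / 4) : ℝ) *
        (Complex.exp (-Complex.I * s * d) * (Real.exp (-1 / 2 * s * t) : ℂ) +
          Complex.exp (Complex.I * s * d) * (Real.exp (1 / 2 * s * t) : ℂ))) := by
  have hg : ∀ y : ℝ, Real.exp (-y ^ 2) = √Real.pi * gaussDens (1 / 2) (y - 0) := by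
    intro y
    have : √Real.pi ≠ 0 := by positivity
    simp only [gaussDens, sub_zero]
    rw [show 2 * Real.pi * (1 / 2) = Real.pi by ring, ← mul_assoc, mul_inv_cancel₀ this, one_mul]
    congr 1; ring
  have hp : ∀ y : ℝ, (Real.exp (-y ^ 2) * Real.cos (s * (y - d))) • Complex.exp (Complex.I * t * y) =
      ((√Real.pi / 2 : ℝ) : ℂ) * Complex.exp (-Complex.I * s * d) *
        (Complex.exp (Complex.I * ((t + s : ℝ) : ℂ) * y) * (gaussDens (1 / 2) (y - 0) : ℂ)) +
      ((√Real.pi / 2 : ℝ) : ℂ) * Complex.exp (Complex.I * s * d) *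
        (Complex.exp (Complex.I * ((t - s : ℝ) : ℂ) * y) * (gaussDens (1 / 2) (y - 0) : ℂ)) := by
    intro y
    rw [Complex.real_smul, hg, Complex.ofReal_mul, Complex.ofReal_cos, Complex.cos]
    have e1 : Complex.exp (-Complex.I * s * d) * Complex.exp (Complex.I * ((t + s : ℝ) : ℂ) * y) =
        Complex.exp (((s * (y - d) : ℝ) : ℂ) * Complex.I) * Complex.exp (Complex.I * t * y) := by
      rw [← Complex.exp_add, ← Complex.exp_add]; push_cast; ring_nf
    have e2 : Complex.exp (Complex.I * s * d) * Complex.exp (Complex.I * ((t - s : ℝ) : ℂ) * y) =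
        Complex.exp (-((s * (y - d) : ℝ) : ℂ) * Complex.I) * Complex.exp (Complex.I * t * y) := by
      rw [← Complex.exp_add, ← Complex.exp_add]; push_cast; ring_nf
    push_cast at e1 e2 ⊢
    linear_combination (-(√Real.pi / 2 * gaussDens (1 / 2) (y - 0) : ℂ)) * (e1 + e2)
  have hi : ∀ r : ℝ, Integrable fun y : ℝ =>
      Complex.exp (Complex.I * r * y) * (gaussDens (1 / 2) (y - 0) : ℂ) := by
    intro r
    refine ((integrable_gaussDens_sub (by norm_num) 0).ofReal (𝕜 := ℂ)).bdd_mul (c := 1)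
      (by fun_prop) (Eventually.of_forall fun y => ?_)
    rw [show Complex.I * r * y = ((r * y : ℝ) : ℂ) * Complex.I by push_cast; ring,
      Complex.norm_exp_ofReal_mul_I]
  simp_rw [hp]
  rw [integral_add ((hi _).const_mul _) ((hi _).const_mul _), integral_const_mul,
    integral_const_mul, integral_cexp_mul_gaussDens (by norm_num),
    integral_cexp_mul_gaussDens (by norm_num)]
  have e1 : Real.exp (-(1 / 2) * (t + s) ^ 2 / 2) =
      Real.exp (-t ^ 2 / 4) * Real.exp (-s ^ 2 / 4) * Real.exp (-1 / 2 * s * t) := by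
    rw [← Real.exp_add, ← Real.exp_add]; ring_nf
  have e2 : Real.exp (-(1 / 2) * (t - s) ^ 2 / 2) =
      Real.exp (-t ^ 2 / 4) * Real.exp (-s ^ 2 / 4) * Real.exp (1 / 2 * s * t) := by
    rw [← Real.exp_add, ← Real.exp_add]; ring_nf
  rw [e1, e2, Complex.ofReal_zero, mul_zero, Complex.exp_zero, mul_zero, Complex.exp_zero]
  simp only [Complex.ofReal_mul]
  ring

theorem gaussianDecay_cosKernel {l d τ : ℝ} (hl : 0 ≤ l) (hτ : 0 ≤ τ) :
    GaussianDecay fun t => ∫ x : ℝ, Complex.exp (Complex.I * t * x) * (cosKernel l d τ x : ℂ) := by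
  let a : ℝ → ℝ := fun s => (2 * Real.pi)⁻¹ * Real.exp (-l * s ^ 2) *
    (√Real.pi / 2 * Real.exp (-s ^ 2 / 4))
  let a₁ : ℝ → ℂ := fun s => (a s : ℂ) * Complex.exp (-Complex.I * s * d)
  let a₂ : ℝ → ℂ := fun s => (a s : ℂ) * Complex.exp (Complex.I * s * d)
  have ha : Continuous a := by simp only [a]; fun_prop
  have ha₁ : Continuous a₁ := by simp only [a₁]; fun_prop
  have ha₂ : Continuous a₂ := by simp only [a₂]; fun_prop
  have h : ∀ t : ℝ, ∫ x : ℝ, Complex.exp (Complex.I * t * x) * (cosKernel l d τ x : ℂ) =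
      (Real.exp (-t ^ 2 / 4) : ℂ) * (∫ s in -τ..τ, a₁ s * (Real.exp (-1 / 2 * s * t) : ℂ)) +
      (Real.exp (-t ^ 2 / 4) : ℂ) * (∫ s in -τ..τ, a₂ s * (Real.exp (1 / 2 * s * t) : ℂ)) := by
    intro t
    have h1 := integral_cosKernel_smul (E := ℂ) (d := d) hl hτ
      (ψ := fun y : ℝ => Complex.exp (Complex.I * t * y)) (by fun_prop) (B := 1) (fun y => by
        rw [show Complex.I * t * y = ((t * y : ℝ) : ℂ) * Complex.I by push_cast; ring,
          Complex.norm_exp_ofReal_mul_I])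
    simp only [Complex.real_smul, mul_comm _ (Complex.exp _)] at h1
    rw [h1, ← mul_add, ← intervalIntegral.integral_add, ← intervalIntegral.integral_const_mul]
    · refine intervalIntegral.integral_congr fun s _ => ?_
      have h2 := integral_exp_mul_cos_mul_cexp s d t
      simp only [Complex.real_smul, mul_comm _ (Complex.exp _)] at h2
      simp only [h2, a₁, a₂, a]
      push_cast
      ring
    · exact Continuous.intervalIntegrable (by fun_prop) _ _
    · exact Continuous.intervalIntegrable (by fun_prop) _ _
  simp_rw [h]
  exact (GaussianDecay.exp_mul_integral ha₁ hτ _).add (GaussianDecay.exp_mul_integral ha₂ hτ _)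

theorem gaussianDecay_shiftKernel {d δ τ : ℝ} (hδ : 0 ≤ δ) (hδ1 : δ < 1 / 2) (hτ : 0 ≤ τ) :
    GaussianDecay fun t => ∫ x : ℝ,
      Complex.exp (Complex.I * t * x) * (shiftKernel d δ τ x : ℂ) := by
  have h1 : 0 < 1 - 2 * δ := by linarith
  unfold shiftKernel
  simp only [Complex.ofReal_mul, mul_left_comm (Complex.exp (Complex.I * _ * _)),
    mul_assoc ((√(1 / (1 - 2 * δ)) : ℝ) : ℂ), integral_const_mul]
  exact ((gaussianDecay_cosKernel (by positivity) hτ).const_mul _).const_mul _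

/-! ### Absolute moments. -/

theorem integrable_abs_rpow_mul_gaussDens_one {q : ℝ} (hq : 0 < q) :
    Integrable fun x => |x| ^ q * gaussDens 1 x := by
  have h : MemLp id (ENNReal.ofReal q) (gaussianReal 0 1) :=
    memLp_id_gaussianReal' _ ENNReal.ofReal_ne_top
  have h1 := h.integrable_norm_rpow (by simpa using hq) ENNReal.ofReal_ne_top
  rw [gaussianReal_of_var_ne_zero _ one_ne_zero, integrable_withDensity_iff_integrable_smul'
    (measurable_gaussianPDF _ _) (Eventually.of_forall fun _ => gaussianPDF_lt_top),
    ENNReal.toReal_ofReal hq.le] at h1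
  refine h1.congr (Eventually.of_forall fun x => ?_)
  have := gaussianPDFReal_eq_gaussDens 0 zero_le_one x
  rw [Real.toNNReal_one, sub_zero] at this
  simp [toReal_gaussianPDF, this, mul_comm]

theorem integral_abs_rpow_mul_gaussDens_one (q : ℝ) :
    ∫ x, |x| ^ q * gaussDens 1 x = gaussianMoment q := by
  rw [gaussianMoment, integral_gaussianReal_eq_integral_smul one_ne_zero]
  refine integral_congr_ae (Eventually.of_forall fun x => ?_)
  have := gaussianPDFReal_eq_gaussDens 0 zero_le_one x
  rw [Real.toNNReal_one, sub_zero] at this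
  simp [this, mul_comm]

theorem gaussDens_scale {v : ℝ} (hv : 0 < v) (x : ℝ) :
    gaussDens v x = (√v)⁻¹ * gaussDens 1 ((√v)⁻¹ * x) := by
  unfold gaussDens
  rw [Real.sqrt_mul (by positivity), mul_one, mul_inv, mul_pow, inv_pow, Real.sq_sqrt hv.le]
  have : -x ^ 2 / (2 * v) = -(v⁻¹ * x ^ 2) / (2 * 1) := by field_simp
  rw [this]
  ring

theorem lintegral_abs_rpow_mul_gaussDens {q : ℝ} (hq : 0 < q) {v : ℝ} (hv : 0 < v) :
    ∫⁻ x, ENNReal.ofReal (|x| ^ q * gaussDens v x) =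
      ENNReal.ofReal (√v ^ q * gaussianMoment q) := by
  have hs : 0 < √v := by positivity
  have h : ∀ x, |x| ^ q * gaussDens v x =
      √v ^ q * (√v)⁻¹ * (|(√v)⁻¹ * x| ^ q * gaussDens 1 ((√v)⁻¹ * x)) := by
    intro x
    rw [gaussDens_scale hv, abs_mul, abs_of_pos (inv_pos.2 hs),
      Real.mul_rpow (by positivity) (by positivity), Real.inv_rpow hs.le]
    have : √v ^ q ≠ 0 := by positivity
    field_simp
  have hi := (integrable_abs_rpow_mul_gaussDens_one hq).comp_mul_left' (inv_ne_zero hs.ne')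
  rw [← ofReal_integral_eq_lintegral_ofReal]
  · simp_rw [h]
    rw [integral_const_mul, Measure.integral_comp_mul_left
      (fun x => |x| ^ q * gaussDens 1 x), integral_abs_rpow_mul_gaussDens_one, inv_inv,
      abs_of_pos hs, smul_eq_mul]
    congr 1
    field_simp
  · simp_rw [h]
    exact hi.const_mul _
  · exact Eventually.of_forall fun x => mul_nonneg (by positivity) (gaussDens_nonneg _ _)

theorem gaussianMoment_nonneg (q : ℝ) : 0 ≤ gaussianMoment q :=
  integral_nonneg fun x => by positivity

/-- A density dominated by a multiple of a mixture of two centered Gaussian densities inherits a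
moment bound. -/
theorem lintegral_abs_rpow_mul_le {q : ℝ} (hq : 0 < q) {f : ℝ → ℝ} {κ ε v w s : ℝ} (hκ : 0 ≤ κ)
    (hε0 : 0 ≤ ε) (hε1 : ε ≤ 1) (hv : 0 < v) (hw : 0 < w) (hvs : v ≤ s) (hws : w ≤ s)
    (hf : ∀ x, f x ≤ (1 + κ) * ((1 - ε) * gaussDens v x + ε * gaussDens w x)) :
    ∫⁻ x, ENNReal.ofReal (|x| ^ q * f x) ≤
      ENNReal.ofReal ((1 + κ) * (√s ^ q * gaussianMoment q)) := by
  have hM := gaussianMoment_nonneg q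
  have h1 : ∀ x, ENNReal.ofReal (|x| ^ q * f x) ≤
      ENNReal.ofReal ((1 + κ) * (1 - ε)) * ENNReal.ofReal (|x| ^ q * gaussDens v x) +
        ENNReal.ofReal ((1 + κ) * ε) * ENNReal.ofReal (|x| ^ q * gaussDens w x) := by
    intro x
    have n1 := gaussDens_nonneg v x
    have n2 := gaussDens_nonneg w x
    have n3 : 0 ≤ 1 - ε := by linarith
    rw [← ENNReal.ofReal_mul (by positivity), ← ENNReal.ofReal_mul (by positivity),
      ← ENNReal.ofReal_add (by positivity) (by positivity)]
    refine ENNReal.ofReal_le_ofReal ?_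
    calc _ ≤ |x| ^ q * ((1 + κ) * ((1 - ε) * gaussDens v x + ε * gaussDens w x)) := by
          gcongr; exact hf x
      _ = _ := by ring
  refine (lintegral_mono h1).trans ?_
  have n3 : 0 ≤ 1 - ε := by linarith
  rw [lintegral_add_left' (by
      refine Measurable.aemeasurable ?_
      have := (continuous_gaussDens v).measurable
      fun_prop), lintegral_const_mul' _ _ ENNReal.ofReal_ne_top,
    lintegral_const_mul' _ _ ENNReal.ofReal_ne_top, lintegral_abs_rpow_mul_gaussDens hq hv,
    lintegral_abs_rpow_mul_gaussDens hq hw, ← ENNReal.ofReal_mul (by positivity),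
    ← ENNReal.ofReal_mul (by positivity), ← ENNReal.ofReal_add (by positivity) (by positivity)]
  refine ENNReal.ofReal_le_ofReal ?_
  have e1 : √v ^ q ≤ √s ^ q := by gcongr
  have e2 : √w ^ q ≤ √s ^ q := by gcongr
  calc _ ≤ (1 + κ) * (1 - ε) * (√s ^ q * gaussianMoment q) +
        (1 + κ) * ε * (√s ^ q * gaussianMoment q) := by gcongr
    _ = _ := by ring

/-- Follows from `(x - δ)² + δ - (1 - δ)x² = δ(x - 1)² + δ² ≥ 0`. It reduces the moment of the
shifted null component to that of a centered Gaussian. -/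
theorem gaussDens_sub_le {v δ : ℝ} (hv : 0 < v) (hδ : 0 < δ) (hδ1 : δ < 1) (x : ℝ) :
    gaussDens v (x - δ) ≤
      √(1 / (1 - δ)) * Real.exp (δ / (2 * v)) * gaussDens (v / (1 - δ)) x := by
  have h1 : 0 < 1 - δ := by linarith
  have hs : √(1 / (1 - δ)) * (√(2 * Real.pi * (v / (1 - δ))))⁻¹ = (√(2 * Real.pi * v))⁻¹ := by
    rw [← Real.sqrt_inv, ← Real.sqrt_inv, ← Real.sqrt_mul (by positivity)]
    congr 1
    field_simp
  have he : Real.exp (-(x - δ) ^ 2 / (2 * v)) ≤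
      Real.exp (δ / (2 * v)) * Real.exp (-x ^ 2 / (2 * (v / (1 - δ)))) := by
    rw [← Real.exp_add]
    refine Real.exp_le_exp.2 ?_
    rw [show δ / (2 * v) + -x ^ 2 / (2 * (v / (1 - δ))) = (δ - x ^ 2 * (1 - δ)) / (2 * v) by
      field_simp
      ring]
    gcongr
    nlinarith [mul_nonneg hδ.le (sq_nonneg (x - 1)), sq_nonneg δ]
  unfold gaussDens
  rw [← hs]
  calc _ ≤ √(1 / (1 - δ)) * (√(2 * Real.pi * (v / (1 - δ))))⁻¹ *
        (Real.exp (δ / (2 * v)) * Real.exp (-x ^ 2 / (2 * (v / (1 - δ))))) := by gcongr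
    _ = _ := by ring

/-! ### Marginal densities as convolutions. -/

theorem EligibleMixture.density_ofDensity_eq {u₀ σ₀ ε : ℝ} {k : ℝ → ℝ} (hσ : 0 < σ₀)
    (hε0 : 0 < ε) (hε1 : ε < 1) (hk : Measurable k) (hk0 : ∀ u, 0 ≤ k u) (hki : Integrable k)
    (hk1 : ∫ u, k u = 1) (x : ℝ) :
    (EligibleMixture.ofDensity u₀ σ₀ ε k hσ hε0 hε1 hk hk0 hki hk1).density x =
      (1 - ε) * gaussDens (σ₀ ^ 2) (x - u₀) + ε * ∫ u, k u * gaussDens (σ₀ ^ 2) (x - u) := by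
  rw [EligibleMixture.density_ofDensity]
  simp only [scaled_gaussianPDFReal hσ]

theorem integrable_cosKernel {l d τ : ℝ} (hl : 0 ≤ l) :
    Integrable (cosKernel l d τ) := by
  refine (integrable_exp_neg_sq.const_mul ((2 * Real.pi)⁻¹ * (1 * |τ - -τ|))).mono'
    (continuous_cosKernel l d τ).aestronglyMeasurable (Eventually.of_forall fun y => ?_)
  have h := intervalIntegral.norm_integral_le_of_norm_le_const (a := -τ) (b := τ)
    (f := fun s => Real.exp (-l * s ^ 2) * Real.cos (s * (y - d))) (C := 1) (fun s _ => by
      rw [norm_mul, Real.norm_of_nonneg (Real.exp_pos _).le, Real.norm_eq_abs]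
      exact mul_le_one₀ (Real.exp_le_one_iff.2 (by nlinarith [mul_nonneg hl (sq_nonneg s)]))
        (abs_nonneg _) (Real.abs_cos_le_one _))
  unfold cosKernel
  rw [norm_mul, Real.norm_of_nonneg (by positivity)]
  calc _ ≤ (2 * Real.pi)⁻¹ * Real.exp (-y ^ 2) * (1 * |τ - -τ|) := by gcongr
    _ = _ := by ring

theorem integrable_shiftKernel {d δ τ : ℝ} (hδ : 0 ≤ δ) (hδ1 : δ < 1 / 2) :
    Integrable (shiftKernel d δ τ) := by
  have h1 : 0 < 1 - 2 * δ := by linarith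
  exact (integrable_cosKernel (by positivity)).const_mul _

theorem integrable_mul_gaussDens_sub {k : ℝ → ℝ} (hk : Integrable k) (v x : ℝ) :
    Integrable fun u => k u * gaussDens v (x - u) :=
  hk.mul_bdd (c := (√(2 * Real.pi * v))⁻¹) (by fun_prop)
    (Eventually.of_forall fun _ => norm_gaussDens_le v _)

theorem integrable_conv_gaussDens {k : ℝ → ℝ} (hk : Integrable k) {v : ℝ} (hv : 0 < v) :
    Integrable fun x => ∫ u, k u * gaussDens v (x - u) :=
  hk.integrable_convolution (ContinuousLinearMap.mul ℝ ℝ) (integrable_gaussDens hv.le)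

theorem integral_conv_gaussDens {k : ℝ → ℝ} (hk : Integrable k) {v : ℝ} (hv : 0 < v) :
    ∫ x, ∫ u, k u * gaussDens v (x - u) = ∫ u, k u := by
  have := integral_convolution (ContinuousLinearMap.mul ℝ ℝ) hk (integrable_gaussDens hv.le)
  rw [integral_gaussDens hv, ContinuousLinearMap.mul_apply', mul_one] at this
  exact this

theorem EligibleMixture.integrable_density_ofDensity {u₀ σ₀ ε : ℝ} {k : ℝ → ℝ} (hσ : 0 < σ₀)
    (hε0 : 0 < ε) (hε1 : ε < 1) (hk : Measurable k) (hk0 : ∀ u, 0 ≤ k u) (hki : Integrable k)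
    (hk1 : ∫ u, k u = 1) :
    Integrable (EligibleMixture.ofDensity u₀ σ₀ ε k hσ hε0 hε1 hk hk0 hki hk1).density := by
  rw [funext (EligibleMixture.density_ofDensity_eq hσ hε0 hε1 hk hk0 hki hk1)]
  exact ((integrable_gaussDens_sub (sq_nonneg _) _).const_mul _).add
    ((integrable_conv_gaussDens hki (by positivity)).const_mul _)

theorem EligibleMixture.integral_density_ofDensity {u₀ σ₀ ε : ℝ} {k : ℝ → ℝ} (hσ : 0 < σ₀)
    (hε0 : 0 < ε) (hε1 : ε < 1) (hk : Measurable k) (hk0 : ∀ u, 0 ≤ k u) (hki : Integrable k)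
    (hk1 : ∫ u, k u = 1) :
    ∫ x, (EligibleMixture.ofDensity u₀ σ₀ ε k hσ hε0 hε1 hk hk0 hki hk1).density x = 1 := by
  simp_rw [EligibleMixture.density_ofDensity_eq hσ hε0 hε1 hk hk0 hki hk1]
  rw [integral_add ((integrable_gaussDens_sub (sq_nonneg _) _).const_mul _)
    ((integrable_conv_gaussDens hki (by positivity)).const_mul _), integral_const_mul,
    integral_const_mul, integral_conv_gaussDens hki (by positivity), hk1,
    integral_sub_right_eq_self (fun x => gaussDens (σ₀ ^ 2) x), integral_gaussDens (by positivity)]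
  ring

/-! ### The perturbed mixing density. -/

/-- A kernel whose convolution with the density of `N(0, v)` approximates the difference of the
densities of `N(δ, v + δ)` and `N(0, v)`. -/
def bump (δ τ y : ℝ) : ℝ := shiftKernel δ δ τ y - shiftKernel 0 0 τ y

theorem continuous_bump (δ τ : ℝ) : Continuous (bump δ τ) :=
  (continuous_shiftKernel _ _ _).sub (continuous_shiftKernel _ _ _)

theorem integrable_bump {δ τ : ℝ} (hδ : 0 ≤ δ) (hδ1 : δ < 1 / 2) : Integrable (bump δ τ) :=
  (integrable_shiftKernel hδ hδ1).sub (integrable_shiftKernel le_rfl (by norm_num))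

/-- The density of `N(0, 1/2 + δ)`, perturbed by a multiple of `bump`. -/
def perturbedDens (δ τ θ u : ℝ) : ℝ :=
  (1 - θ * ∫ y, bump δ τ y) * gaussDens (1 / 2 + δ) u + θ * bump δ τ u

theorem continuous_perturbedDens (δ τ θ : ℝ) : Continuous (perturbedDens δ τ θ) := by
  unfold perturbedDens
  have := continuous_bump δ τ
  fun_prop

theorem integrable_perturbedDens {δ τ θ : ℝ} (hδ : 0 ≤ δ) (hδ1 : δ < 1 / 2) :
    Integrable (perturbedDens δ τ θ) :=
  ((integrable_gaussDens (by linarith)).const_mul _).add ((integrable_bump hδ hδ1).const_mul _)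

theorem integral_perturbedDens {δ τ θ : ℝ} (hδ : 0 ≤ δ) (hδ1 : δ < 1 / 2) :
    ∫ u, perturbedDens δ τ θ u = 1 := by
  unfold perturbedDens
  rw [integral_add ((integrable_gaussDens (by linarith)).const_mul _)
    ((integrable_bump hδ hδ1).const_mul _), integral_const_mul, integral_const_mul,
    integral_gaussDens (by linarith)]
  ring

theorem exp_neg_sq_le {δ : ℝ} (hδ : 0 ≤ δ) (hδ1 : δ ≤ 1 / 4) (y : ℝ) :
    Real.exp (-y ^ 2) ≤ 3 * gaussDens (1 / 2 + δ) y := by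
  have h1 : √(2 * Real.pi * (1 / 2 + δ)) ≤ 3 := by
    rw [Real.sqrt_le_left (by norm_num)]
    nlinarith [Real.pi_lt_d2, Real.pi_pos]
  have h2 : 0 < √(2 * Real.pi * (1 / 2 + δ)) := by positivity
  have h3 : Real.exp (-y ^ 2) ≤ Real.exp (-y ^ 2 / (2 * (1 / 2 + δ))) := by
    refine Real.exp_le_exp.2 ?_
    rw [le_div_iff₀ (by positivity)]
    nlinarith [mul_nonneg hδ (sq_nonneg y)]
  unfold gaussDens
  rw [← mul_assoc]
  refine h3.trans (le_mul_of_one_le_left (Real.exp_pos _).le ?_)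
  rw [← div_eq_mul_inv, le_div_iff₀ h2]
  linarith

theorem abs_mul_bump_le {δ τ θ κ : ℝ} (hδ : 0 ≤ δ) (hδ1 : δ ≤ 1 / 4) (hτ : 1 ≤ τ) (hθ : 0 ≤ θ)
    (h : 18 * θ * δ * τ ^ 3 ≤ κ) (u : ℝ) :
    |θ * bump δ τ u| ≤ κ / 2 * gaussDens (1 / 2 + δ) u := by
  rw [abs_mul, abs_of_nonneg hθ]
  have hG := gaussDens_nonneg (1 / 2 + δ) u
  calc _ ≤ θ * (3 * δ * τ ^ 3 * (3 * gaussDens (1 / 2 + δ) u)) := by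
        gcongr
        refine (abs_shiftKernel_sub_le hδ hδ1 hτ u).trans ?_
        gcongr
        exact exp_neg_sq_le hδ hδ1 u
    _ = (18 * θ * δ * τ ^ 3) / 2 * gaussDens (1 / 2 + δ) u := by ring
    _ ≤ _ := by gcongr

/-- Half of `κ` pays for the bump and half for the correction that restores total mass one. For `κ ≤
1` this gives nonnegativity, and the upper bound it gives controls the moment. -/
theorem abs_perturbedDens_sub_le {δ τ θ κ : ℝ} (hδ : 0 ≤ δ) (hδ1 : δ ≤ 1 / 4) (hτ : 1 ≤ τ)
    (hθ : 0 ≤ θ) (h : 18 * θ * δ * τ ^ 3 ≤ κ) (u : ℝ) :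
    |perturbedDens δ τ θ u - gaussDens (1 / 2 + δ) u| ≤ κ * gaussDens (1 / 2 + δ) u := by
  have h1 := abs_mul_bump_le hδ hδ1 hτ hθ h
  have h2 : |θ * ∫ y, bump δ τ y| ≤ κ / 2 := by
    rw [← integral_const_mul, ← Real.norm_eq_abs]
    refine (norm_integral_le_of_norm_le ((integrable_gaussDens (by linarith)).const_mul (κ / 2))
      (Eventually.of_forall h1)).trans ?_
    rw [integral_const_mul, integral_gaussDens (by linarith), mul_one]
  have hG := gaussDens_nonneg (1 / 2 + δ) u
  rw [show perturbedDens δ τ θ u - gaussDens (1 / 2 + δ) u =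
    -((θ * ∫ y, bump δ τ y) * gaussDens (1 / 2 + δ) u) + θ * bump δ τ u by
      unfold perturbedDens; ring]
  refine (abs_add_le _ _).trans ?_
  rw [abs_neg, abs_mul (θ * _), abs_of_nonneg hG]
  calc _ ≤ κ / 2 * gaussDens (1 / 2 + δ) u + κ / 2 * gaussDens (1 / 2 + δ) u := by
        gcongr; exact h1 u
    _ = _ := by ring

theorem gaussianDecay_perturbedDens {δ τ θ : ℝ} (hδ : 0 ≤ δ) (hδ1 : δ < 1 / 2) (hτ : 0 ≤ τ) :
    GaussianDecay fun t => ∫ x : ℝ,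
      Complex.exp (Complex.I * t * x) * (perturbedDens δ τ θ x : ℂ) := by
  have hi : ∀ (t : ℝ) {g : ℝ → ℝ}, Integrable g → Integrable fun x : ℝ =>
      Complex.exp (Complex.I * t * x) * (g x : ℂ) := by
    intro t g hg
    refine (hg.ofReal (𝕜 := ℂ)).bdd_mul (c := 1)
      (by fun_prop) (Eventually.of_forall fun y => ?_)
    rw [show Complex.I * t * y = ((t * y : ℝ) : ℂ) * Complex.I by push_cast; ring,
      Complex.norm_exp_ofReal_mul_I]
  have h1 := gaussianDecay_gaussDens (v := 1 / 2 + δ) (by linarith) 0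
  have h2 := gaussianDecay_shiftKernel (d := δ) hδ hδ1 hτ
  have h3 := gaussianDecay_shiftKernel (d := 0) (le_refl (0 : ℝ)) (by norm_num) hτ
  unfold perturbedDens
  generalize (1 - θ * ∫ y, bump δ τ y) = c
  convert ((h1.const_mul (c : ℂ)).add (h2.const_mul (θ : ℂ))).add
    (h3.const_mul (-θ : ℂ)) using 2 with t
  have i1 := hi t (integrable_gaussDens_sub (show 0 ≤ 1 / 2 + δ by linarith) 0)
  have i2 := hi t (integrable_shiftKernel (d := δ) (τ := τ) hδ hδ1)
  have i3 := hi t (integrable_shiftKernel (d := 0) (δ := 0) (τ := τ) le_rfl (by norm_num))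
  rw [← integral_const_mul, ← integral_const_mul, ← integral_const_mul,
    ← integral_add (i1.const_mul _) (i2.const_mul _)]
  refine Eq.trans ?_ (integral_add ((i1.const_mul _).add (i2.const_mul _)) (i3.const_mul _))
  refine integral_congr_ae (Eventually.of_forall fun x => ?_)
  simp only [sub_zero, Complex.ofReal_add, Complex.ofReal_mul,
    show bump δ τ x = shiftKernel δ δ τ x - shiftKernel 0 0 τ x from rfl, Complex.ofReal_sub]
  ring

theorem integrable_envelope {v : ℝ} (hv : 0 < v) : Integrable (envelope v) := by
  have := (integrable_exp_neg_mul_sq (show 0 < 1 / (2 * (1 / 2 + v)) by positivity)).const_mul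
    (√((1 / 2) / (1 / 2 + v)))
  refine this.congr (Eventually.of_forall fun x => ?_)
  simp only [envelope]
  congr 2
  ring

theorem envelope_nonneg (v x : ℝ) : 0 ≤ envelope v x := by unfold envelope; positivity

/-- The bound on the error, in `L¹`, of the approximations given by `shiftKernel`. -/
def truncationError (v τ : ℝ) : ℝ :=
  (∫ x, envelope v x) * √(Real.pi / ((1 / 2) * v / (1 / 2 + v) / 4)) *
    Real.exp (-((1 / 2) * v / (1 / 2 + v)) / 4 * τ ^ 2)

theorem integral_abs_sub_conv_bump_le {v δ τ : ℝ} (hv : 0 < v) (hδ : 0 ≤ δ) (hδ1 : δ ≤ 1 / 4)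
    (hτ : 0 ≤ τ) :
    ∫ x, |gaussDens (v + δ) (x - δ) - gaussDens v x - ∫ u, bump δ τ u * gaussDens v (x - u)| ≤
      4 * truncationError v τ := by
  set E := Real.exp (-((1 / 2) * v / (1 / 2 + v)) * τ ^ 2 / 4) *
    √(Real.pi / ((1 / 2) * v / (1 / 2 + v) / 4)) with hE
  have hE0 : 0 ≤ E := by positivity
  have hT : 4 * truncationError v τ = ∫ x, envelope v x * (4 * E) := by
    rw [integral_mul_const, truncationError, hE,
      show -((1 / 2) * v / (1 / 2 + v)) * τ ^ 2 / 4 =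
        -((1 / 2) * v / (1 / 2 + v)) / 4 * τ ^ 2 by ring]
    ring
  rw [hT]
  refine integral_mono_of_nonneg (Eventually.of_forall fun x => abs_nonneg _)
    ((integrable_envelope hv).mul_const _) (Eventually.of_forall fun x => ?_)
  have a1 := abs_gaussDens_sub_conv_shiftKernel_le hv hδ (by linarith) hτ δ x
  have a0 := abs_gaussDens_sub_conv_shiftKernel_le hv le_rfl (by norm_num) hτ 0 x
  rw [← hE] at a1 a0
  have hb : ∫ u, bump δ τ u * gaussDens v (x - u) =
      (∫ u, shiftKernel δ δ τ u * gaussDens v (x - u)) -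
        ∫ u, shiftKernel 0 0 τ u * gaussDens v (x - u) := by
    rw [← integral_sub (integrable_mul_gaussDens_sub (integrable_shiftKernel hδ (by linarith)) _ _)
      (integrable_mul_gaussDens_sub (integrable_shiftKernel le_rfl (by norm_num)) _ _)]
    simp only [bump, sub_mul]
  have hx := envelope_nonneg v x
  have hc := sqrt_mul_exp_le hδ hδ1
  -- The prefactor is at most `1 + 6δ ≤ 3`. The unshifted kernel has prefactor `1`, and together
  -- they give the `4`.
  have a1' : |gaussDens (v + δ) (x - δ) - ∫ u, shiftKernel δ δ τ u * gaussDens v (x - u)| ≤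
      3 * (envelope v x * E) := a1.trans (by gcongr; linarith)
  have a0' : |gaussDens v x - ∫ u, shiftKernel 0 0 τ u * gaussDens v (x - u)| ≤
      envelope v x * E := by simpa using a0
  simp only
  rw [hb, show gaussDens (v + δ) (x - δ) - gaussDens v x -
      ((∫ u, shiftKernel δ δ τ u * gaussDens v (x - u)) -
        ∫ u, shiftKernel 0 0 τ u * gaussDens v (x - u)) =
      (gaussDens (v + δ) (x - δ) - ∫ u, shiftKernel δ δ τ u * gaussDens v (x - u)) -
        (gaussDens v x - ∫ u, shiftKernel 0 0 τ u * gaussDens v (x - u)) by ring]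
  refine (abs_sub _ _).trans ?_
  linarith

/-! ### The two models and the lower bound. -/

/-- The two-point lower bound for both risks, from a pair of mixtures whose null means and null
variances differ by `δ`. -/
theorem risk_ge {α β ε₀ q a A : ℝ} (hq : 0 < q) (ha : 0 < a) {n : ℕ} (hn : n ≠ 0)
    {κ ε δ τ : ℝ} (hκ0 : 0 < κ) (hκ1 : κ ≤ 1)
    (hκA : (1 + κ) * (√(a ^ 2 + 1) ^ q * gaussianMoment q) ≤ A ^ q)
    (hε : ε ≤ ε₀ * (n : ℝ) ^ (-β)) (hε0 : 0 < ε) (hε1 : ε < 1) (hδ : 0 < δ) (hδ1 : δ ≤ 1 / 4)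
    (hτ : 1 ≤ τ) (hsmall : 18 * δ * τ ^ 3 ≤ κ * ε)
    (hshift : √(1 / (1 - δ)) * Real.exp (δ / (2 * a ^ 2)) ≤ 1 + κ)
    (hvar : (a ^ 2 + δ) / (1 - δ) ≤ a ^ 2 + 1)
    (herr : 8 * truncationError (a ^ 2) τ ≤ 1 / (2 * n)) :
    ENNReal.ofReal (δ ^ 2 / 8) ≤ riskσ α β ε₀ q a A n ∧
      ENNReal.ofReal (δ ^ 2 / 8) ≤ riskU α β ε₀ q a A n := by
  have hδ2 : δ < 1 / 2 := by linarith
  have hτ0 : 0 ≤ τ := by linarith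
  have ha2 : 0 < a ^ 2 := by positivity
  have hε1' : 0 < 1 - ε := by linarith
  -- The bump is scaled so that, after weighting by `ε`, it enters with the weight `1 - ε` of the
  -- null part.
  set θ := (1 - ε) / ε with hθ
  have hθ0 : 0 ≤ θ := by positivity
  have hεθ : ε * θ = 1 - ε := by rw [hθ]; field_simp
  have hθκ : 18 * θ * δ * τ ^ 3 ≤ κ := by
    have h1 : θ ≤ 1 / ε := by rw [hθ]; gcongr; linarith
    calc 18 * θ * δ * τ ^ 3 = θ * (18 * δ * τ ^ 3) := by ring
      _ ≤ 1 / ε * (κ * ε) := by gcongr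
      _ = κ := by field_simp
  have hk := abs_perturbedDens_sub_le hδ.le hδ1 hτ hθ0 hθκ
  have hk0 : ∀ u, 0 ≤ perturbedDens δ τ θ u := fun u => by
    have h1 := (abs_le.1 (hk u)).1
    nlinarith [gaussDens_nonneg (1 / 2 + δ) u]
  have hkle : ∀ u, perturbedDens δ τ θ u ≤ (1 + κ) * gaussDens (1 / 2 + δ) u := fun u => by
    have h1 := (abs_le.1 (hk u)).2
    linarith
  have hki := integrable_perturbedDens (τ := τ) (θ := θ) hδ.le hδ2
  have hkm := (continuous_perturbedDens δ τ θ).measurable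
  have hk1 := integral_perturbedDens (τ := τ) (θ := θ) hδ.le hδ2
  have hσ : 0 < √(a ^ 2 + δ) := by positivity
  have hσ2 : √(a ^ 2 + δ) ^ 2 = a ^ 2 + δ := Real.sq_sqrt (by positivity)
  have hgm := (continuous_gaussDens (1 / 2)).measurable
  have hgi := integrable_gaussDens (v := 1 / 2) (by norm_num)
  have hg1 := integral_gaussDens (v := 1 / 2) (by norm_num)
  -- The Gaussian parts of the nonnull components agree up to mass correction: `a² + (1/2 + δ)` in
  -- `M` and `(a² + δ) + 1/2` in `N`.
  let M := EligibleMixture.ofDensity 0 a ε (perturbedDens δ τ θ) ha hε0 hε1 hkm hk0 hki hk1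
  let N := EligibleMixture.ofDensity δ √(a ^ 2 + δ) ε (gaussDens (1 / 2)) hσ hε0 hε1 hgm
    (gaussDens_nonneg _) hgi hg1
  have hMi : Integrable M.density :=
    EligibleMixture.integrable_density_ofDensity ha hε0 hε1 hkm hk0 hki hk1
  have hNi : Integrable N.density :=
    EligibleMixture.integrable_density_ofDensity hσ hε0 hε1 hgm (gaussDens_nonneg _) hgi hg1
  have hM1 : ∫ x, M.density x = 1 :=
    EligibleMixture.integral_density_ofDensity ha hε0 hε1 hkm hk0 hki hk1
  have hMd : ∀ x, M.density x = (1 - ε) * gaussDens (a ^ 2) x +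
      ε * ∫ u, perturbedDens δ τ θ u * gaussDens (a ^ 2) (x - u) := fun x => by
    have := EligibleMixture.density_ofDensity_eq (u₀ := 0) ha hε0 hε1 hkm hk0 hki hk1 x
    rwa [sub_zero] at this
  have hconv : ∀ v w : ℝ, 0 < v → 0 < w → ∀ x,
      ∫ u, gaussDens w u * gaussDens v (x - u) = gaussDens (v + w) x := fun v w hv hw x => by
    rw [← integral_gaussDens_mul_gaussDens hv hw]
    simp only [mul_comm]
  have hNd : ∀ x, N.density x = (1 - ε) * gaussDens (a ^ 2 + δ) (x - δ) +
      ε * gaussDens (a ^ 2 + (1 / 2 + δ)) x := fun x => by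
    have := EligibleMixture.density_ofDensity_eq (u₀ := δ) hσ hε0 hε1 hgm
      (gaussDens_nonneg _) hgi hg1 x
    rw [hσ2, hconv _ _ (by positivity) (by norm_num)] at this
    rw [show a ^ 2 + (1 / 2 + δ) = a ^ 2 + δ + 1 / 2 by ring]
    exact this
  have hbi := integrable_bump (τ := τ) hδ.le hδ2
  obtain ⟨η, hη⟩ : ∃ η, η = ∫ y, bump δ τ y := ⟨_, rfl⟩
  let D : ℝ → ℝ := fun x => gaussDens (a ^ 2 + δ) (x - δ) - gaussDens (a ^ 2) x -
    ∫ u, bump δ τ u * gaussDens (a ^ 2) (x - u)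
  have hi1 := integrable_gaussDens_sub (show 0 ≤ a ^ 2 + δ by positivity) δ
  have hi2 := integrable_gaussDens ha2.le
  have hi3 := integrable_conv_gaussDens hbi ha2
  have hi4 := integrable_gaussDens (show 0 ≤ a ^ 2 + (1 / 2 + δ) by positivity)
  have hDi : Integrable D := (hi1.sub hi2).sub hi3
  -- Both Gaussian densities have mass one and convolution preserves mass. Hence the mass correction
  -- `η` is itself bounded by the truncation error, and the total error is twice `4 *
  -- truncationError`.
  have hDη : ∫ x, D x = -η := by
    have e1 : ∫ x, (gaussDens (a ^ 2 + δ) (x - δ) - gaussDens (a ^ 2) x) = 0 := by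
      rw [integral_sub hi1 hi2, integral_sub_right_eq_self (fun x => gaussDens (a ^ 2 + δ) x),
        integral_gaussDens (by positivity), integral_gaussDens ha2, sub_self]
    refine (integral_sub (hi1.sub hi2) hi3).trans ?_
    rw [integral_conv_gaussDens hbi ha2, ← hη]
    simp only [Pi.sub_apply]
    rw [e1, zero_sub]
  have hDle : ∫ x, |D x| ≤ 4 * truncationError (a ^ 2) τ :=
    integral_abs_sub_conv_bump_le ha2 hδ.le hδ1 hτ0
  have hηle : |η| ≤ ∫ x, |D x| := by
    rw [← abs_neg, ← hDη]
    exact abs_integral_le_integral_abs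
  have hdiff : ∀ x, M.density x - N.density x =
      -((1 - ε) * (D x + η * gaussDens (a ^ 2 + (1 / 2 + δ)) x)) := fun x => by
    have e1 : ∫ u, perturbedDens δ τ θ u * gaussDens (a ^ 2) (x - u) =
        (1 - θ * η) * gaussDens (a ^ 2 + (1 / 2 + δ)) x +
          θ * ∫ u, bump δ τ u * gaussDens (a ^ 2) (x - u) := by
      rw [← hconv _ _ ha2 (by positivity), ← integral_const_mul, ← integral_const_mul,
        ← integral_add ((integrable_mul_gaussDens_sub (integrable_gaussDens (by positivity))
          _ _).const_mul _) ((integrable_mul_gaussDens_sub hbi _ _).const_mul _)]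
      refine integral_congr_ae (Eventually.of_forall fun u => ?_)
      simp only [perturbedDens, ← hη]
      ring
    rw [hMd, hNd, e1]
    simp only [D]
    linear_combination ((∫ u, bump δ τ u * gaussDens (a ^ 2) (x - u)) -
      η * gaussDens (a ^ 2 + (1 / 2 + δ)) x) * hεθ
  have hL1 : ∫ x, |M.density x - N.density x| ≤ 1 / (2 * n) := by
    refine le_trans (le_trans ?_ (show (∫ x, |D x|) + |η| ≤ 8 * truncationError (a ^ 2) τ by
      linarith)) herr
    have e1 : ∫ x, (|D x| + |η| * gaussDens (a ^ 2 + (1 / 2 + δ)) x) = (∫ x, |D x|) + |η| := by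
      rw [integral_add hDi.abs (hi4.const_mul _), integral_const_mul,
        integral_gaussDens (by positivity), mul_one]
    rw [← e1]
    refine integral_mono (hMi.sub hNi).abs (hDi.abs.add (hi4.const_mul _)) fun x => ?_
    simp only
    rw [hdiff, abs_neg, abs_mul, abs_of_pos hε1']
    refine (mul_le_of_le_one_left (abs_nonneg _) (by linarith)).trans ((abs_add_le _ _).trans ?_)
    rw [abs_mul η, abs_of_nonneg (gaussDens_nonneg _ x)]
  have hMN : ∀ x, M.density x ≤ (1 + κ) * ((1 - ε) * gaussDens (a ^ 2) x +
      ε * gaussDens (a ^ 2 + (1 / 2 + δ)) x) := fun x => by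
    have e1 : ∫ u, perturbedDens δ τ θ u * gaussDens (a ^ 2) (x - u) ≤
        (1 + κ) * gaussDens (a ^ 2 + (1 / 2 + δ)) x := by
      rw [← hconv _ _ ha2 (by positivity), ← integral_const_mul]
      refine integral_mono (integrable_mul_gaussDens_sub hki _ _)
        ((integrable_mul_gaussDens_sub (integrable_gaussDens (by positivity)) _ _).const_mul _)
        fun u => ?_
      simp only
      rw [← mul_assoc]
      exact mul_le_mul_of_nonneg_right (hkle u) (gaussDens_nonneg _ _)
    rw [hMd]
    have e2 : 0 ≤ κ * ((1 - ε) * gaussDens (a ^ 2) x) := by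
      have := gaussDens_nonneg (a ^ 2) x
      positivity
    nlinarith [mul_le_mul_of_nonneg_left e1 hε0.le]
  have hNN : ∀ x, N.density x ≤ (1 + κ) * ((1 - ε) * gaussDens ((a ^ 2 + δ) / (1 - δ)) x +
      ε * gaussDens (a ^ 2 + (1 / 2 + δ)) x) := fun x => by
    have e1 : gaussDens (a ^ 2 + δ) (x - δ) ≤
        (1 + κ) * gaussDens ((a ^ 2 + δ) / (1 - δ)) x := by
      refine (gaussDens_sub_le (by positivity) hδ (by linarith) x).trans
        (mul_le_mul_of_nonneg_right (le_trans ?_ hshift) (gaussDens_nonneg _ _))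
      gcongr
      linarith
    rw [hNd]
    have e2 : 0 ≤ κ * (ε * gaussDens (a ^ 2 + (1 / 2 + δ)) x) := by
      have := gaussDens_nonneg (a ^ 2 + (1 / 2 + δ)) x
      positivity
    nlinarith [mul_le_mul_of_nonneg_left e1 hε1'.le]
  have hMF : MemF₀ α β ε₀ q a A n M := by
    have hd := gaussianDecay_perturbedDens (θ := θ) hδ.le hδ2 hτ0
    refine MemF₀.of_gaussianDecay le_rfl ((lintegral_abs_rpow_mul_le hq hκ0.le hε0.le hε1.le ha2
      (by positivity) (s := a ^ 2 + 1) (by linarith) (by linarith) hMN).trans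
      (ENNReal.ofReal_le_ofReal hκA)) hε hd hd (fun _ _ => rfl) (fun _ t => ?_)
    simp only [EligibleMixture.hTilde, M, EligibleMixture.ofDensity, add_zero]
  have hNF : MemF₀ α β ε₀ q a A n N := by
    have hd := gaussianDecay_gaussDens (v := 1 / 2) le_rfl
    have h1 : 0 < 1 - δ := by linarith
    refine MemF₀.of_gaussianDecay (Real.le_sqrt_of_sq_le (by linarith))
      ((lintegral_abs_rpow_mul_le hq hκ0.le hε0.le hε1.le (by positivity)
      (by positivity) (s := a ^ 2 + 1) hvar (by linarith) hNN).trans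
      (ENNReal.ofReal_le_ofReal hκA)) hε (hd 0) (hd (-δ)) (fun _ t => ?_) (fun _ t => ?_)
    · simp only [EligibleMixture.hHat, N, EligibleMixture.ofDensity, sub_zero]
    · simp only [EligibleMixture.hTilde, N, EligibleMixture.ofDensity, sub_neg_eq_add]
  constructor
  · have h := minimaxRisk_ge (θ := fun M => M.σ₀ ^ 2) hn hMF hNF hMi hNi hM1 hL1
    have e : (M.σ₀ ^ 2 - N.σ₀ ^ 2) ^ 2 / 8 = δ ^ 2 / 8 := by
      simp only [M, N, EligibleMixture.ofDensity, hσ2]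
      ring
    simp only [e] at h
    exact h
  · have h := minimaxRisk_ge (θ := fun M => M.u₀) hn hMF hNF hMi hNi hM1 hL1
    have e : (M.u₀ - N.u₀) ^ 2 / 8 = δ ^ 2 / 8 := by
      simp only [M, N, EligibleMixture.ofDensity]
      ring
    simp only [e] at h
    exact h

theorem exists_moment_slack {q a A : ℝ} (hq : 0 < q)
    (hA : √(a ^ 2 + 1) * gaussianMoment q ^ (1 / q) < A) :
    ∃ κ : ℝ, 0 < κ ∧ κ ≤ 1 ∧ (1 + κ) * (√(a ^ 2 + 1) ^ q * gaussianMoment q) ≤ A ^ q := by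
  have hM := gaussianMoment_nonneg q
  have h1 : √(a ^ 2 + 1) ^ q * gaussianMoment q < A ^ q := by
    have := Real.rpow_lt_rpow (by positivity) hA hq
    rwa [Real.mul_rpow (by positivity) (by positivity), ← Real.rpow_mul hM,
      one_div_mul_cancel hq.ne', Real.rpow_one] at this
  set m := √(a ^ 2 + 1) ^ q * gaussianMoment q
  have hm : 0 ≤ m := by positivity
  -- Any `κ` with `κ m ≤ A^q - m` works; dividing by `m + 1` avoids a separate case `m = 0`.
  refine ⟨min 1 ((A ^ q - m) / (m + 1)), lt_min one_pos (div_pos (by linarith) (by linarith)),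
    min_le_left _ _, ?_⟩
  have h2 : min 1 ((A ^ q - m) / (m + 1)) * (m + 1) ≤ A ^ q - m := by
    rw [← le_div_iff₀ (by linarith)]; exact min_le_right _ _
  have h3 : 0 ≤ min 1 ((A ^ q - m) / (m + 1)) :=
    le_min zero_le_one (div_nonneg (by linarith) (by linarith))
  linarith

/-! ### Choice of the parameters and the rates. -/

theorem eventually_risk_ge {α β ε₀ q a A : ℝ} (hα : 2 < α) (hβ0 : 0 ≤ β) (hε0 : 0 < ε₀)
    (hε1 : ε₀ < 1) (hq : 0 < q) (ha : 0 < a)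
    (hA : √(a ^ 2 + 1) * gaussianMoment q ^ (1 / q) < A) :
    ∀ᶠ n : ℕ in atTop,
      ENNReal.ofReal ((ε₀ * (n : ℝ) ^ (-β) * Real.log n ^ (-(α + 1) / 2)) ^ 2 / 8) ≤
        riskσ α β ε₀ q a A n ∧
      ENNReal.ofReal ((ε₀ * (n : ℝ) ^ (-β) * Real.log n ^ (-(α + 1) / 2)) ^ 2 / 8) ≤
        riskU α β ε₀ q a A n := by
  obtain ⟨κ, hκ0, hκ1, hκA⟩ := exists_moment_slack hq hA
  have ha2 : 0 < a ^ 2 := by positivity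
  set r := (1 / 2) * a ^ 2 / (1 / 2 + a ^ 2) with hr
  have hr0 : 0 < r := by positivity
  have hlog : Tendsto (fun n : ℕ => Real.log n) atTop atTop :=
    Real.tendsto_log_atTop.comp tendsto_natCast_atTop_atTop
  have hpow : ∀ p : ℝ, 0 < p → Tendsto (fun n : ℕ => Real.log n ^ (-p)) atTop (nhds 0) :=
    fun p hp => (tendsto_rpow_neg_atTop hp).comp hlog
  have hδ : Tendsto (fun n : ℕ => ε₀ * (n : ℝ) ^ (-β) * Real.log n ^ (-(α + 1) / 2)) atTop
      (nhds 0) := by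
    refine squeeze_zero' ?_ ?_ (hpow ((α + 1) / 2) (by linarith))
    · exact Eventually.of_forall fun n => by
        have := Real.log_natCast_nonneg n
        positivity
    · filter_upwards [eventually_ge_atTop 1] with n hn
      have hn1 : (1 : ℝ) ≤ n := by exact_mod_cast hn
      rw [neg_div]
      refine mul_le_of_le_one_left (Real.rpow_nonneg (Real.log_natCast_nonneg n) _) ?_
      exact mul_le_one₀ hε1.le (by positivity)
        (Real.rpow_le_one_of_one_le_of_nonpos hn1 (by linarith))
  have hδ1 := hδ.eventually_le_const (show (0 : ℝ) < 1 / 4 by norm_num)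
  have hδ2 : ∀ᶠ δ in nhds (0 : ℝ),
      √(1 / (1 - δ)) * Real.exp (δ / (2 * a ^ 2)) ≤ 1 + κ := by
    have hc : ContinuousAt (fun δ : ℝ => √(1 / (1 - δ)) * Real.exp (δ / (2 * a ^ 2))) 0 := by
      have : ContinuousAt (fun δ : ℝ => 1 / (1 - δ)) 0 :=
        ContinuousAt.div (by fun_prop) (by fun_prop) (by norm_num)
      exact this.sqrt.mul (by fun_prop)
    refine hc.eventually_le_const ?_
    simpa using hκ0
  have hδ3 : ∀ᶠ δ in nhds (0 : ℝ), (a ^ 2 + δ) / (1 - δ) ≤ a ^ 2 + 1 := by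
    have hc : ContinuousAt (fun δ : ℝ => (a ^ 2 + δ) / (1 - δ)) 0 :=
      ContinuousAt.div (by fun_prop) (by fun_prop) (by norm_num)
    refine hc.eventually_le_const ?_
    simp
  have hsmall : ∀ᶠ n : ℕ in atTop,
      18 * √(8 / r) ^ 3 * Real.log n ^ (-((α - 2) / 2)) ≤ κ := by
    have := (hpow ((α - 2) / 2) (by linarith)).const_mul (18 * √(8 / r) ^ 3)
    rw [mul_zero] at this
    exact this.eventually_le_const hκ0
  set B := (∫ x, envelope (a ^ 2) x) * √(Real.pi / (r / 4)) with hB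
  -- The threshold `r / 8` for `log n` gives `τ ≥ 1`; the threshold `16 * B` for `n` turns the
  -- truncation error `B n⁻²` into the required `8 B n⁻² ≤ 1/(2n)`.
  filter_upwards [eventually_ge_atTop 1, hδ1, hδ.eventually hδ2, hδ.eventually hδ3, hsmall,
    hlog.eventually_ge_atTop 1, hlog.eventually_ge_atTop (r / 8),
    tendsto_natCast_atTop_atTop.eventually_ge_atTop (16 * B)] with n hn h1 h2 h3 h4 h5 h6 h7
  have hn0 : (0 : ℝ) < n := by exact_mod_cast hn
  have hn1 : (1 : ℝ) ≤ n := by exact_mod_cast hn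
  set L := Real.log n with hL
  have hL0 : 0 < L := by linarith
  have hτ2 : √(8 / r * L) ^ 2 = 8 / r * L := Real.sq_sqrt (by positivity)
  have hnβ : (n : ℝ) ^ (-β) ≤ 1 := Real.rpow_le_one_of_one_le_of_nonpos hn1 (by linarith)
  refine risk_ge hq ha (by omega) (ε := ε₀ * (n : ℝ) ^ (-β)) (τ := √(8 / r * L)) hκ0 hκ1 hκA le_rfl
    (by positivity) ?_ (by positivity) h1 ?_ ?_ h2 h3 ?_
  · exact lt_of_le_of_lt (mul_le_of_le_one_right hε0.le hnβ) hε1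
  · refine Real.one_le_sqrt.2 ?_
    rw [div_mul_eq_mul_div, le_div_iff₀ hr0]
    linarith
  · have e1 : √(8 / r * L) ^ 3 = √(8 / r) ^ 3 * L ^ (3 / 2 : ℝ) := by
      rw [Real.sqrt_mul (by positivity), mul_pow, Real.sqrt_eq_rpow L, ← Real.rpow_natCast,
        ← Real.rpow_natCast (L ^ (1 / 2 : ℝ)), ← Real.rpow_mul hL0.le]
      norm_num
    have e2 : L ^ (-(α + 1) / 2) * L ^ (3 / 2 : ℝ) = L ^ (-((α - 2) / 2)) := by
      rw [← Real.rpow_add hL0]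
      congr 1
      ring
    calc _ = (18 * √(8 / r) ^ 3 * (L ^ (-(α + 1) / 2) * L ^ (3 / 2 : ℝ))) *
          (ε₀ * (n : ℝ) ^ (-β)) := by rw [e1]; ring
      _ ≤ _ := by rw [e2]; gcongr
  -- The constant `8 / r` in `τ²` makes the exponent `-r τ²/4` equal to `-2 log n`.
  · have e1 : truncationError (a ^ 2) √(8 / r * L) = B * ((n : ℝ) ^ 2)⁻¹ := by
      rw [truncationError, ← hr, ← hB, hτ2,
        show -r / 4 * (8 / r * L) = -(2 * L) by field_simp; norm_num, Real.exp_neg,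
        show Real.exp (2 * L) = (n : ℝ) ^ 2 by
          rw [two_mul, Real.exp_add, hL, Real.exp_log hn0, sq]]
    rw [e1, ← div_eq_mul_inv, ← mul_div_assoc, div_le_div_iff₀ (by positivity) (by positivity)]
    nlinarith

end NullEstimation

end

theorem theorem2p1 (α β ε₀ q a A : ℝ) (hα : 2 < α) (hβ0 : 0 ≤ β) (hβ : β < 1 / 2)
    (hε0 : 0 < ε₀) (hε1 : ε₀ < 1) (hq : 0 < q) (ha : 0 < a)
    (hA : Real.sqrt (a ^ 2 + 1) * NullEstimation.gaussianMoment q ^ (1 / q) < A) :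
    ∃ C : ℝ, 0 < C ∧
      ENNReal.ofReal C ≤ liminf (fun n : ℕ =>
        ENNReal.ofReal ((n : ℝ) ^ (2 * β) * Real.log n ^ (α + 2)) *
          NullEstimation.riskσ α β ε₀ q a A n) atTop ∧
      ENNReal.ofReal C ≤ liminf (fun n : ℕ =>
        ENNReal.ofReal ((n : ℝ) ^ (2 * β) * Real.log n ^ (α + 1)) *
          NullEstimation.riskU α β ε₀ q a A n) atTop := by
  have hrisk := NullEstimation.eventually_risk_ge hα hβ0 hε0 hε1 hq ha hA
  have hlog : ∀ᶠ n : ℕ in atTop, 1 ≤ Real.log n :=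
    (Real.tendsto_log_atTop.comp tendsto_natCast_atTop_atTop).eventually_ge_atTop 1
  -- The same `δ` serves both risks: the mean takes `p = α + 1`, and for the variance the larger
  -- exponent `α + 2` only helps.
  have key : ∀ n : ℕ, 1 ≤ n → 1 ≤ Real.log n → ∀ p : ℝ, α + 1 ≤ p →
      ENNReal.ofReal (ε₀ ^ 2 / 8) ≤ ENNReal.ofReal ((n : ℝ) ^ (2 * β) * Real.log n ^ p) *
        ENNReal.ofReal ((ε₀ * (n : ℝ) ^ (-β) * Real.log n ^ (-(α + 1) / 2)) ^ 2 / 8) := by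
    intro n hn hL p hp
    have hn0 : (0 : ℝ) < n := by exact_mod_cast hn
    have hL0 : 0 < Real.log n := by linarith
    rw [← ENNReal.ofReal_mul (by positivity)]
    refine ENNReal.ofReal_le_ofReal ?_
    have e1 : (n : ℝ) ^ (2 * β) * ((n : ℝ) ^ (-β)) ^ 2 = 1 := by
      rw [← Real.rpow_natCast ((n : ℝ) ^ (-β)), ← Real.rpow_mul hn0.le, ← Real.rpow_add hn0]
      convert Real.rpow_zero _ using 2
      push_cast
      ring
    have e2 : 1 ≤ Real.log n ^ p * (Real.log n ^ (-(α + 1) / 2)) ^ 2 := by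
      rw [← Real.rpow_natCast (Real.log n ^ (-(α + 1) / 2)), ← Real.rpow_mul hL0.le,
        ← Real.rpow_add hL0]
      refine Real.one_le_rpow hL ?_
      push_cast
      linarith
    calc ε₀ ^ 2 / 8 ≤ ε₀ ^ 2 / 8 * (Real.log n ^ p * (Real.log n ^ (-(α + 1) / 2)) ^ 2) :=
          le_mul_of_one_le_right (by positivity) e2
      _ = ε₀ ^ 2 / 8 * ((n : ℝ) ^ (2 * β) * ((n : ℝ) ^ (-β)) ^ 2) *
          (Real.log n ^ p * (Real.log n ^ (-(α + 1) / 2)) ^ 2) := by rw [e1, mul_one]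
      _ = _ := by ring
  refine ⟨ε₀ ^ 2 / 8, by positivity, ?_, ?_⟩
  · refine le_liminf_of_le (by isBoundedDefault) ?_
    filter_upwards [hrisk, hlog, eventually_ge_atTop 1] with n h hL hn
    exact (key n hn hL _ (by linarith)).trans (mul_le_mul_right h.1 _)
  · refine le_liminf_of_le (by isBoundedDefault) ?_
    filter_upwards [hrisk, hlog, eventually_ge_atTop 1] with n h hL hn
    exact (key n hn hL _ le_rfl).trans (mul_le_mul_right h.2 _)
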